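/- Let $n\ge 1$ and $N_1,N_2\ge 0$ be integers. Let $A=QA_{-N_1}^{N_2}(2n+1)$ be the quotient of the polynomial algebra $\mathbb{C}[f^i[s],g_j[t],h[k]]$ ($1\le i,j\le n$, $-N_1\le s,t,k\le N_2$) by the ideal generated by $$r[l]=\sum_{s+t=l}\Big(\sum_{i=1}^n f^i[s]g_i[t]+h[s]h[t]\Big),\qquad -2N_1\le l\le 2N_2,$$ where $s,t$ run over $-N_1,\dots,N_2$. Grade $A=\bigoplus_{d\ge0}A_d$ by the degree in the generators. (1) $A$ is a Koszul algebra: it is quadratic (it is a graded algebra with $A_0=\mathbb{C}$, it is generated by $A_1$, and the kernel of the map from the tensor algebra of $A_1$ to $A$ is generated, as a two-sided ideal, by its elements of degree $2$), and its trivial module $\mathbb{C}=A/A_+$ has a graded free resolution $\cdots\to P_2\to P_1\to P_0=A\to\mathbb{C}\to 0$ in which $P_i$ is generated in degree $i$ for every $i$. (2) Define the level of a generator by $\operatorname{lev} f^i[s]=2ns-i$, $\operatorname{lev} h[k]=2nk$, $\operatorname{lev} g_i[t]=2nt+i$, and write $\alpha\preceq\beta$ if $\operatorname{lev}\alpha<\operatorname{lev}\beta$,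 or if $\alpha=\beta$ is not one of the $h[k]$. A $\hat{\mathcal G}$-monomial is a product $\alpha_1\cdots\alpha_m$ ($m\ge0$) of generators with $\alpha_i\preceq\alpha_j$ for $i<j$ (so $g_n[t]$ and $f^n[t+1]$ do not occur together, and each $h[k]$ occurs at most once). Then the $\hat{\mathcal G}$-monomials form a Poincaré–Birkhoff–Witt basis of $A$. That is, for every total order $<$ on the set of generators such that $\operatorname{lev}\alpha<\operatorname{lev}\beta$ implies $\alpha<\beta$, the following hold. Call $(\alpha,\beta)$ a PBW pair if $\alpha\beta\in A$ is not a linear combination of products $\gamma\delta$ with $(\gamma,\delta)$ lexicographically smaller than $(\alpha,\beta)$. The generators form a basis of $A_1$; the products $\alpha_1\cdots\alpha_m$ over all words in which every pair $(\alpha_i,\alpha_{i+1})$ is a PBW pair form a basis of $A$; and these words are exactly those of the $\hat{\mathcal G}$-monomials. -/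

import Mathlib

/-! ## Quadratic, Koszul and PBW algebras -/

namespace GradedAlg

universe u v

section General

variable (k : Type v) {A : Type u} [Field k] [Ring A] [Algebra k A]

/-- The canonical algebra map from the tensor algebra of `A₁` to `A`. -/
noncomputable def fromTensor (𝒜 : ℕ → Submodule k A) : TensorAlgebra k (𝒜 1) →ₐ[k] A :=
  TensorAlgebra.lift k (𝒜 1).subtype

/-- The quadratic relations: the kernel of `A₁ ⊗ A₁ → A₂`, inside the tensor algebra of `A₁`. -/
def quadraticRelations (𝒜 : ℕ → Submodule k A) : Set (TensorAlgebra k (𝒜 1)) :=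
  {x | x ∈ LinearMap.range (TensorAlgebra.ι k : 𝒜 1 →ₗ[k] TensorAlgebra k (𝒜 1)) ^ 2 ∧
    fromTensor k 𝒜 x = 0}

/-- `A = ⨁ 𝒜 d` is a graded algebra with `A₀ = k`, generated by `A₁`, and all the relations
between elements of `A₁` follow from the quadratic ones. -/
structure IsQuadratic (𝒜 : ℕ → Submodule k A) : Prop where
  gradedMonoid : SetLike.GradedMonoid 𝒜
  isInternal : DirectSum.IsInternal 𝒜
  algebraMap_injective : Function.Injective (algebraMap k A)
  zero_eq : 𝒜 0 = 1
  generated : Algebra.adjoin k (𝒜 1 : Set A) = ⊤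
  relations : TwoSidedIdeal.ker (fromTensor k 𝒜) = TwoSidedIdeal.span (quadraticRelations k 𝒜)

/-- The trivial module `k = A / A₊`, placed in degree `0`, has a linear graded free resolution
`⋯ → P₂ → P₁ → P₀ = A → k → 0`: here `P i` is the free left `A`-module on a set `ι i` of generators
of degree `i`. That the differential preserves degrees means that the coordinates of the
images of the basis vectors lie in `A₁`. -/
def HasLinearResolution (𝒜 : ℕ → Submodule k A) : Prop :=
  ∃ (ι : ℕ → Type u) (d : ∀ i, (ι (i + 1) →₀ A) →ₗ[A] (ι i →₀ A)),
    Nonempty (Unique (ι 0)) ∧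
    (∀ i (e : ι (i + 1)) (j : ι i), d i (Finsupp.single e 1) j ∈ 𝒜 1) ∧
    (∀ p : ι 0 →₀ A, p ∈ LinearMap.range (d 0) ↔ ∀ j, p j ∈ ⨆ m : ℕ, 𝒜 (m + 1)) ∧
    (∀ i, LinearMap.range (d (i + 1)) = LinearMap.ker (d i))

/-- A Koszul algebra: a quadratic algebra whose trivial module has a linear free resolution
(equivalently, `Ext` of the trivial module by itself is concentrated on the diagonal). -/
structure IsKoszul (𝒜 : ℕ → Submodule k A) : Prop where
  isQuadratic : IsQuadratic k 𝒜
  linearResolution : HasLinearResolution k 𝒜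

variable {σ : Type*}

/-- With respect to a strict total order `lt` on the index set of the generators `x`,
the pair `(α, β)` is a PBW pair if `x α * x β` is not a linear combination of the products
`x p * x q` with `(p, q)` lexicographically smaller than `(α, β)`. -/
def PBWPair (lt : σ → σ → Prop) (x : σ → A) (α β : σ) : Prop :=
  x α * x β ∉ Submodule.span k {a | ∃ p q, Prod.Lex lt lt (p, q) (α, β) ∧ a = x p * x q}

/-- PBW words: all pairs of consecutive letters are PBW pairs. -/
def IsPBWWord (lt : σ → σ → Prop) (x : σ → A) (w : List σ) : Prop :=
  w.IsChain (PBWPair k lt x)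

/-- `x` is a system of PBW generators of the quadratic algebra `A`: it is a basis of `A₁`, and
the products along PBW words (the PBW monomials) form a basis of `A`, called a PBW basis. -/
structure IsPBW (𝒜 : ℕ → Submodule k A) (lt : σ → σ → Prop) (x : σ → A) : Prop where
  isQuadratic : IsQuadratic k 𝒜
  linearIndependent : LinearIndependent k x
  span_eq : Submodule.span k (Set.range x) = 𝒜 1
  linearIndependent_words :
    LinearIndependent k (fun w : {w : List σ // IsPBWWord k lt x w} => (w.1.map x).prod)
  span_words :
    Submodule.span k (Set.range fun w : {w : List σ // IsPBWWord k lt x w} => (w.1.map x).prod) = ⊤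

end General

end GradedAlg

/-! ## The algebra of quasimaps to an odd-dimensional quadric -/

namespace OddQuadric

/-- The Fourier modes `-N₁ ≤ t ≤ N₂`. -/
abbrev Mode (N₁ N₂ : ℕ) : Type := Set.Icc (-(N₁ : ℤ)) (N₂ : ℤ)

/-- The generators `fⁱ[s]`, `gᵢ[t]`, `h[k]`; the index `i : Fin n` stands for `i + 1 ∈ {1, …, n}`. -/
inductive Gen (n N₁ N₂ : ℕ) : Type
  | f (i : Fin n) (s : Mode N₁ N₂)
  | g (i : Fin n) (t : Mode N₁ N₂)
  | h (k : Mode N₁ N₂)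

variable (n N₁ N₂ : ℕ)

open scoped Classical in
/-- The coefficient at `z ^ l` of `∑ fⁱ(z) gᵢ(z) + h(z) ^ 2`. -/
noncomputable def relation (l : ℤ) : MvPolynomial (Gen n N₁ N₂) ℂ :=
  ∑ s : Mode N₁ N₂, ∑ t : Mode N₁ N₂,
    if (s : ℤ) + (t : ℤ) = l then
      (∑ i : Fin n, MvPolynomial.X (Gen.f i s) * MvPolynomial.X (Gen.g i t))
        + MvPolynomial.X (Gen.h s) * MvPolynomial.X (Gen.h t)
    else 0

/-- The ideal generated by the relations of index `-2N₁ ≤ l ≤ 2N₂`. -/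
noncomputable def relationIdeal : Ideal (MvPolynomial (Gen n N₁ N₂) ℂ) :=
  Ideal.span (relation n N₁ N₂ '' Set.Icc (-(2 * (N₁ : ℤ))) (2 * (N₂ : ℤ)))

/-- The algebra of quasimaps to the quadric in the space of dimension `2n + 1`. -/
abbrev QA : Type := MvPolynomial (Gen n N₁ N₂) ℂ ⧸ relationIdeal n N₁ N₂

/-- The class of a generator. -/
noncomputable def gen (α : Gen n N₁ N₂) : QA n N₁ N₂ :=
  Ideal.Quotient.mk (relationIdeal n N₁ N₂) (MvPolynomial.X α)

/-- The grading by the degree in the generators. -/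
noncomputable def grading (d : ℕ) : Submodule ℂ (QA n N₁ N₂) :=
  (MvPolynomial.homogeneousSubmodule (Gen n N₁ N₂) ℂ d).map
    (Ideal.Quotient.mkₐ ℂ (relationIdeal n N₁ N₂)).toLinearMap

variable {n N₁ N₂}

/-- The level of a vertex in the periodic Hasse diagram
`⋯ → f²[t] → f¹[t] → h[t] → g₁[t] → g₂[t] → ⋯ → gₙ₋₁[t] → {gₙ[t], fⁿ[t+1]} → fⁿ⁻¹[t+1] → ⋯`.
Only the two vertices in braces share a level. -/
def Gen.level : Gen n N₁ N₂ → ℤ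
  | .f i s => 2 * (n : ℤ) * (s : ℤ) - (((i : ℕ) : ℤ) + 1)
  | .g i t => 2 * (n : ℤ) * (t : ℤ) + (((i : ℕ) : ℤ) + 1)
  | .h k => 2 * (n : ℤ) * (k : ℤ)

/-- The vertices `h[k]`, which are not reflexive. -/
def Gen.IsH : Gen n N₁ N₂ → Prop
  | .h _ => True
  | _ => False

/-- The weak partial order of the diagram: `α ≤ β` if there is a path of arrows from `α` to `β`
or if `α = β` is different from all `h[k]`. -/
def Gen.wle (α β : Gen n N₁ N₂) : Prop :=
  α.level < β.level ∨ (α = β ∧ ¬ α.IsH)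

/-- The Ĝ-monomials, i.e. the products of generators that are pairwise comparable in the weak
order (so `h[k]` occurs at most once). Each is written, uniquely, with increasing factors. -/
def IsGMonomial (w : List (Gen n N₁ N₂)) : Prop :=
  w.Pairwise Gen.wle

end OddQuadric

/-! Every term of `r[l]` has total level 2nl, and exactly one term has two factors of equal level
nl: `h[k]²` for l = 2k, `g_n[k] f^n[k+1]` for l = 2k+1. In every other term the levels of the
factors lie strictly on both sides of nl. The square is convex, so a weight "constant minus level
squared" makes these middle terms leading.

Middle terms of different relations share no variable. Hence the products of a standard monomial
(one divisible by no middle term) and powers of the relations have distinct leading terms, which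
exhaust all monomials. They form a basis of the polynomial ring, those with some relation as a
factor span the ideal, and the standard monomials are independent in the quotient
(`MiddleTerms.linearIndependent_standard`). Standard monomials are the products of pairwise
comparable generators.

PBW: an incomparable pair is a middle term, and its relation rewrites it through pairs with a first
factor of smaller level, which are lexicographically smaller for every compatible order.
Independence shows that comparable pairs cannot be so rewritten. Rewriting in the tensor algebra
uses only quadratic relations and ends in PBW words, so independence of these words gives both the
basis and quadraticity (`isPBW_of_linearIndependent`).

Koszulness: the sets of generators closed under raising the level form a Koszul filtration. When
such a set is divided out from the top level down, the annihilator of `x α` modulo its predecessors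
is generated by all β not weakly below α (`MiddleTerms.colon`). From such a filtration a linear
resolution is built by tracking ideals of leading coefficients of syzygies
(`LinearSyzygies.exists_next`). -/

namespace GradedAlg

open scoped Classical

/-! ### Rewriting words along a total order -/

section Words

variable {σ : Type*}

/-- The value of a word of digits `rk a`, read in base `N`. -/
def wordValue (rk : σ → ℕ) (N : ℕ) : List σ → ℕ
  | [] => 0
  | a :: w => rk a * N ^ w.length + wordValue rk N w

theorem wordValue_append (rk : σ → ℕ) (N : ℕ) (u v : List σ) :
    wordValue rk N (u ++ v) = wordValue rk N u * N ^ v.length + wordValue rk N v := by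
  induction u with
  | nil => simp [wordValue]
  | cons a u ih =>
    simp only [List.cons_append, wordValue, ih, List.length_append, pow_add]
    ring

/-- A lexicographically smaller pair is a smaller two-digit number and the other digits stay; this
makes rewriting terminate. -/
theorem wordValue_lt {rk : σ → ℕ} {N : ℕ} {lt : σ → σ → Prop}
    (hlt : ∀ a b, lt a b → rk a < rk b) (hN : ∀ a, rk a < N) {a b p q : σ}
    (h : Prod.Lex lt lt (p, q) (a, b)) (u v : List σ) :
    wordValue rk N (u ++ p :: q :: v) < wordValue rk N (u ++ a :: b :: v) := by
  have hpos : 0 < N ^ v.length := pow_pos ((Nat.zero_le _).trans_lt (hN a)) _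
  have key : rk p * N + rk q < rk a * N + rk b := by
    rcases Prod.lex_iff.1 h with h | ⟨h, h'⟩
    · have h1 := Nat.mul_le_mul_right N (Nat.succ_le_of_lt (hlt _ _ h))
      have h2 := hN q
      simp only [Nat.succ_mul] at h1
      omega
    · have := hlt _ _ h'
      simp only at h this
      subst h
      omega
  simp only [wordValue_append, wordValue, List.length_cons, pow_succ]
  nlinarith [Nat.mul_lt_mul_of_pos_right key hpos]

theorem exists_rank [Finite σ] (lt : σ → σ → Prop) [IsStrictTotalOrder σ lt] :
    ∃ (rk : σ → ℕ) (N : ℕ), (∀ a b, lt a b → rk a < rk b) ∧ ∀ a, rk a < N := by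
  have := Fintype.ofFinite σ
  refine ⟨fun a => (Finset.univ.filter fun b => lt b a).card, Fintype.card σ + 1, ?_, ?_⟩
  · intro a b hab
    apply Finset.card_lt_card
    refine Finset.ssubset_iff.2 ⟨a, by simpa using irrefl_of lt a, ?_⟩
    intro c hc
    rcases Finset.mem_insert.1 hc with rfl | hc
    · simpa using hab
    · have hca : lt c a := by simpa using hc
      simpa using trans_of lt hca hab
  · intro a
    exact Nat.lt_succ_of_le (Finset.card_le_univ _)

end Words

/-! ### Reduction in the tensor algebra modulo quadratic relations -/

section Rewriting

universe u v

variable {k : Type v} {A : Type u} [Field k] [Ring A] [Algebra k A] {σ : Type*}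

theorem fromTensor_ι (𝒜 : ℕ → Submodule k A) (a : 𝒜 1) :
    fromTensor k 𝒜 (TensorAlgebra.ι k a) = a := by
  simp [fromTensor]

/-- The word `w` in the letters `X`. -/
theorem map_word {B C : Type*} [Ring B] [Algebra k B] [Ring C] [Algebra k C] (φ : B →ₐ[k] C)
    (X : σ → B) (w : List σ) : φ (w.map X).prod = (w.map (fun a => φ (X a))).prod := by
  rw [map_list_prod, List.map_map]; rfl

theorem span_words_tensorAlgebra {M : Type*} [AddCommGroup M] [Module k M] {y : σ → M}
    (hy : Submodule.span k (Set.range y) = ⊤) :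
    Submodule.span k (Set.range fun w : List σ =>
      (w.map fun a => TensorAlgebra.ι k (y a)).prod) = ⊤ := by
  set X : σ → TensorAlgebra k M := fun a => TensorAlgebra.ι k (y a) with hX
  set W := Submodule.span k (Set.range fun w : List σ => (w.map X).prod) with hW
  have hone : (1 : TensorAlgebra k M) ∈ W := Submodule.subset_span ⟨[], by simp⟩
  have hmul : ∀ a b, a ∈ W → b ∈ W → a * b ∈ W := by
    intro a b ha hb
    have h : W * W ≤ W := by
      rw [hW, Submodule.span_mul_span, Submodule.span_le]
      rintro _ ⟨_, ⟨w, rfl⟩, _, ⟨w', rfl⟩, rfl⟩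
      exact Submodule.subset_span ⟨w ++ w', by simp⟩
    exact h (Submodule.mul_mem_mul ha hb)
  rw [eq_top_iff]
  intro t _
  induction t using TensorAlgebra.induction with
  | algebraMap r =>
    rw [Algebra.algebraMap_eq_smul_one]
    exact W.smul_mem _ hone
  | ι m =>
    have hm : m ∈ Submodule.span k (Set.range y) := hy ▸ Submodule.mem_top
    have := Submodule.mem_map_of_mem (f := TensorAlgebra.ι k) hm
    rw [Submodule.map_span] at this
    refine (Submodule.span_le.2 ?_) this
    rintro _ ⟨_, ⟨a, rfl⟩, rfl⟩
    exact Submodule.subset_span ⟨[a], by simp [hX]⟩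
  | mul a b ha hb => exact hmul a b (ha trivial) (hb trivial)
  | add a b ha hb => exact W.add_mem (ha trivial) (hb trivial)

theorem quadraticRelations_le_ker (𝒜 : ℕ → Submodule k A) :
    TwoSidedIdeal.span (quadraticRelations k 𝒜) ≤ TwoSidedIdeal.ker (fromTensor k 𝒜) :=
  TwoSidedIdeal.span_le.2 fun _ hx => (TwoSidedIdeal.mem_ker _).2 hx.2

/-- Modulo the quadratic relations, every word is a linear combination of PBW words. -/
theorem word_sub_mem_span [Finite σ] {𝒜 : ℕ → Submodule k A} {lt : σ → σ → Prop}
    [IsStrictTotalOrder σ lt] {x : σ → A} (y : σ → 𝒜 1) (hy : ∀ a, (y a : A) = x a) (w : List σ) :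
    ∃ s ∈ Submodule.span k (Set.range fun w : {w : List σ // IsPBWWord k lt x w} =>
        (w.1.map fun a => TensorAlgebra.ι k (y a)).prod),
      (w.map fun a => TensorAlgebra.ι k (y a)).prod - s ∈
        TwoSidedIdeal.span (quadraticRelations k 𝒜) := by
  set X : σ → TensorAlgebra k (𝒜 1) := fun a => TensorAlgebra.ι k (y a) with hX
  set I := TwoSidedIdeal.span (quadraticRelations k 𝒜) with hI
  set W := Submodule.span k (Set.range fun w : {w : List σ // IsPBWWord k lt x w} =>
        (w.1.map X).prod) with hW
  obtain ⟨rk, N, hlt, hN⟩ := exists_rank lt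
  induction hv : wordValue rk N w using Nat.strong_induction_on generalizing w with
  | _ m ih =>
    subst hv
    by_cases hw : IsPBWWord k lt x w
    · exact ⟨_, Submodule.subset_span ⟨⟨w, hw⟩, rfl⟩, by simp [I.zero_mem]⟩
    have hsplit : ∃ (a b : σ) (u v : List σ), w = u ++ a :: b :: v ∧ ¬ PBWPair k lt x a b := by
      by_contra hcon
      push Not at hcon
      refine hw (List.isChain_iff_forall_rel_of_append_cons_cons.2 ?_)
      intro a b u v h
      exact hcon a b u v h
    obtain ⟨a, b, u, v, rfl, hab⟩ := hsplit
    have hab' : x a * x b ∈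
        Submodule.span k {c | ∃ p q, Prod.Lex lt lt (p, q) (a, b) ∧ c = x p * x q} :=
      not_not.1 hab
    have hφ : ∀ p q, fromTensor k 𝒜 (X p * X q) = x p * x q := by
      intro p q
      rw [map_mul, hX]
      simp only [fromTensor_ι, hy]
    obtain ⟨t, ht, htx⟩ : ∃ t ∈ Submodule.span k
        {c | ∃ p q, Prod.Lex lt lt (p, q) (a, b) ∧ c = X p * X q},
        fromTensor k 𝒜 t = x a * x b := by
      have : {c | ∃ p q, Prod.Lex lt lt (p, q) (a, b) ∧ c = x p * x q} =
          (fromTensor k 𝒜).toLinearMap ''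
            {c | ∃ p q, Prod.Lex lt lt (p, q) (a, b) ∧ c = X p * X q} := by
        ext c
        constructor
        · rintro ⟨p, q, h, rfl⟩
          exact ⟨_, ⟨p, q, h, rfl⟩, hφ p q⟩
        · rintro ⟨_, ⟨p, q, h, rfl⟩, rfl⟩
          exact ⟨p, q, h, hφ p q⟩
      rw [this, Submodule.span_image] at hab'
      exact hab'
    have hsq : ∀ p q, X p * X q ∈
        LinearMap.range (TensorAlgebra.ι k : 𝒜 1 →ₗ[k] TensorAlgebra k (𝒜 1)) ^ 2 := by
      intro p q
      rw [pow_two]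
      exact Submodule.mul_mem_mul ⟨_, rfl⟩ ⟨_, rfl⟩
    have hrel : X a * X b - t ∈ I := by
      refine TwoSidedIdeal.subset_span ⟨Submodule.sub_mem _ (hsq a b) ?_, ?_⟩
      · refine (Submodule.span_le.2 ?_) ht
        rintro _ ⟨p, q, -, rfl⟩
        exact hsq p q
      · rw [map_sub, hφ, htx, sub_self]
    have hred : ∀ t ∈ Submodule.span k {c | ∃ p q, Prod.Lex lt lt (p, q) (a, b) ∧ c = X p * X q},
        ∃ s ∈ W, (u.map X).prod * t * (v.map X).prod - s ∈ I := by
      intro t ht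
      induction ht using Submodule.span_induction with
      | mem c hc =>
        obtain ⟨p, q, h, rfl⟩ := hc
        obtain ⟨s, hs, hs'⟩ := ih _ (wordValue_lt hlt hN h u v) (u ++ p :: q :: v) rfl
        exact ⟨s, hs, by simpa [mul_assoc] using hs'⟩
      | zero => exact ⟨0, W.zero_mem, by simp [I.zero_mem]⟩
      | add c d _ _ hc hd =>
        obtain ⟨s, hs, hs'⟩ := hc
        obtain ⟨s', hs1, hs1'⟩ := hd
        refine ⟨s + s', W.add_mem hs hs1, ?_⟩
        have := I.add_mem hs' hs1'
        convert! this using 1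
        noncomm_ring
      | smul r c _ hc =>
        obtain ⟨s, hs, hs'⟩ := hc
        refine ⟨r • s, W.smul_mem _ hs, ?_⟩
        have := I.mul_mem_left (algebraMap k _ r) _ hs'
        rw [← Algebra.smul_def, smul_sub] at this
        simpa using this
    obtain ⟨s, hs, hs'⟩ := hred t ht
    refine ⟨s, hs, ?_⟩
    have := I.add_mem (I.mul_mem_right _ (v.map X).prod (I.mul_mem_left (u.map X).prod _ hrel)) hs'
    convert! this using 1
    simp only [List.map_append, List.map_cons, List.prod_append, List.prod_cons]
    noncomm_ring

/-- If the PBW words are linearly independent, then the algebra is quadratic and the PBW words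
form a basis. -/
theorem isPBW_of_linearIndependent [Finite σ] {𝒜 : ℕ → Submodule k A} {lt : σ → σ → Prop}
    [IsStrictTotalOrder σ lt] {x : σ → A}
    (hgm : SetLike.GradedMonoid 𝒜) (hint : DirectSum.IsInternal 𝒜)
    (hinj : Function.Injective (algebraMap k A)) (hzero : 𝒜 0 = 1)
    (hgen : Algebra.adjoin k (𝒜 1 : Set A) = ⊤)
    (hx : LinearIndependent k x) (hspan : Submodule.span k (Set.range x) = 𝒜 1)
    (hind : LinearIndependent k
      (fun w : {w : List σ // IsPBWWord k lt x w} => (w.1.map x).prod)) :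
    IsPBW k 𝒜 lt x := by
  have hx1 : ∀ a, x a ∈ 𝒜 1 := fun a => hspan ▸ Submodule.subset_span ⟨a, rfl⟩
  set y : σ → 𝒜 1 := fun a => ⟨x a, hx1 a⟩ with hy
  set X : σ → TensorAlgebra k (𝒜 1) := fun a => TensorAlgebra.ι k (y a) with hX
  set I := TwoSidedIdeal.span (quadraticRelations k 𝒜) with hI
  set W := Submodule.span k (Set.range fun w : {w : List σ // IsPBWWord k lt x w} =>
        (w.1.map X).prod) with hW
  have hφ : ∀ w : List σ, fromTensor k 𝒜 (w.map X).prod = (w.map x).prod := by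
    intro w
    rw [map_word]
    simp only [hX, fromTensor_ι, hy]
  have hyspan : Submodule.span k (Set.range y) = ⊤ := by
    apply Submodule.map_injective_of_injective (𝒜 1).injective_subtype
    rw [Submodule.map_span, Submodule.map_subtype_top, ← Set.range_comp]
    exact hspan
  have hred : ∀ t : TensorAlgebra k (𝒜 1), ∃ s ∈ W, t - s ∈ I := by
    intro t
    have ht : t ∈ Submodule.span k (Set.range fun w : List σ => (w.map X).prod) :=
      (span_words_tensorAlgebra hyspan).symm ▸ Submodule.mem_top
    induction ht using Submodule.span_induction with
    | mem c hc =>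
      obtain ⟨w, rfl⟩ := hc
      exact word_sub_mem_span y (fun _ => rfl) w
    | zero => exact ⟨0, W.zero_mem, by simp [I.zero_mem]⟩
    | add c d _ _ hc hd =>
      obtain ⟨s, hs, hs'⟩ := hc
      obtain ⟨s', hs1, hs1'⟩ := hd
      refine ⟨s + s', W.add_mem hs hs1, ?_⟩
      have := I.add_mem hs' hs1'
      convert! this using 1
      abel
    | smul r c _ hc =>
      obtain ⟨s, hs, hs'⟩ := hc
      refine ⟨r • s, W.smul_mem _ hs, ?_⟩
      have := I.mul_mem_left (algebraMap k _ r) _ hs'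
      rwa [← Algebra.smul_def, smul_sub] at this
  have hker : ∀ t ∈ I, fromTensor k 𝒜 t = 0 := fun t ht =>
    (TwoSidedIdeal.mem_ker _).1 (quadraticRelations_le_ker 𝒜 ht)
  have hWimage : W.map (fromTensor k 𝒜).toLinearMap =
      Submodule.span k (Set.range fun w : {w : List σ // IsPBWWord k lt x w} =>
        (w.1.map x).prod) := by
    rw [hW, Submodule.map_span, ← Set.range_comp]
    congr 2
    ext w
    exact hφ w.1
  have hsurj : ∀ a : A, ∃ t, fromTensor k 𝒜 t = a := by
    intro a
    have ha : a ∈ Algebra.adjoin k (𝒜 1 : Set A) := hgen ▸ Algebra.mem_top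
    have : Algebra.adjoin k (𝒜 1 : Set A) ≤ (fromTensor k 𝒜).range :=
      Algebra.adjoin_le fun b hb => ⟨TensorAlgebra.ι k ⟨b, hb⟩, fromTensor_ι 𝒜 _⟩
    exact this ha
  refine ⟨⟨hgm, hint, hinj, hzero, hgen, le_antisymm ?_ (quadraticRelations_le_ker 𝒜)⟩,
    hx, hspan, hind, ?_⟩
  -- A relation is congruent, modulo quadratic ones, to a combination of PBW words that vanishes in
  -- `A`; independence makes its coefficients zero.
  · intro t ht
    have ht0 : fromTensor k 𝒜 t = 0 := (TwoSidedIdeal.mem_ker _).1 ht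
    obtain ⟨s, hs, hs'⟩ := hred t
    have hs0 : fromTensor k 𝒜 s = 0 := by
      have := hker _ hs'
      rw [map_sub, ht0, zero_sub, neg_eq_zero] at this
      exact this
    obtain ⟨c, rfl⟩ := (Finsupp.mem_span_range_iff_exists_finsupp).1 hs
    have hc : c = 0 := by
      apply linearIndependent_iff.1 hind
      rw [Finsupp.linearCombination_apply]
      rw [Finsupp.sum, map_sum] at hs0
      simp only [map_smul, hφ] at hs0
      exact hs0
    have htI : t ∈ I := by simpa [hc] using hs'
    exact htI
  · rw [← hWimage, eq_top_iff]
    intro a _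
    obtain ⟨t, rfl⟩ := hsurj a
    obtain ⟨s, hs, hs'⟩ := hred t
    have := hker _ hs'
    rw [map_sub, sub_eq_zero] at this
    exact ⟨s, hs, this.symm⟩

end Rewriting

end GradedAlg

namespace GradedAlg

open scoped Classical

/-! ### Koszul filtrations -/

section KoszulFiltration

universe u v

variable {k : Type v} {A : Type u} [Field k] [CommRing A] [Algebra k A] {σ : Type}

/-- A family `F` of sets of linear forms `x β`, such that successively dividing out the
forms in any set of the family, in the order given by `rk`, the annihilator of each form is generated
by another set of the family. -/
structure KoszulFiltration (𝒜 : ℕ → Submodule k A) (x : σ → A) (rk : σ → ℕ)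
    (F : Set (Set σ)) : Prop where
  injective : Function.Injective rk
  mem_one : ∀ β, x β ∈ 𝒜 1
  colon : ∀ S ∈ F, ∀ α ∈ S, ∃ T ∈ F, ∀ a,
    a * x α ∈ Ideal.span (x '' {β | β ∈ S ∧ rk β < rk α}) ↔ a ∈ Ideal.span (x '' T)

/-- A submodule `Z` of a free module, to be resolved. The basis is ordered by the rank, and the
leading coefficients of `Z` at the basis vector `c` form the ideal generated by the
linear forms in `label c`. -/
structure LinearSyzygies (𝒜 : ℕ → Submodule k A) (x : σ → A) (F : Set (Set σ)) where
  ι : Type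
  rank : ι → ℕ
  injective : Function.Injective rank
  label : ι → Set σ
  label_mem : ∀ c, label c ∈ F
  Z : Submodule A (ι →₀ A)
  lead_mem : ∀ z ∈ Z, ∀ c, (∀ c', rank c < rank c' → z c' = 0) →
    z c ∈ Ideal.span (x '' label c)
  exists_lead : ∀ c, ∀ β ∈ label c, ∃ z ∈ Z, (∀ c', rank c < rank c' → z c' = 0) ∧
    z c = x β ∧ ∀ c', z c' ∈ 𝒜 1

theorem mem_span_mul_of_mem_ideal_span {τ : Type*} (x : τ → A) (S : Set τ) {a : A}
    (ha : a ∈ Ideal.span (x '' S)) :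
    a ∈ Submodule.span k {c | ∃ u : A, ∃ β ∈ S, c = u * x β} := by
  induction ha using Submodule.span_induction with
  | mem c hc =>
    obtain ⟨β, hβ, rfl⟩ := hc
    exact Submodule.subset_span ⟨1, β, hβ, by simp⟩
  | zero => exact Submodule.zero_mem _
  | add c d _ _ hc hd => exact Submodule.add_mem _ hc hd
  | smul r c _ hc =>
    clear * - hc
    induction hc using Submodule.span_induction with
    | mem c hc =>
      obtain ⟨u, β, hβ, rfl⟩ := hc
      exact Submodule.subset_span ⟨r * u, β, hβ, by simp [mul_assoc]⟩
    | zero => simp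
    | add c d _ _ hc hd => rw [smul_add]; exact Submodule.add_mem _ hc hd
    | smul t c _ hc => rw [smul_comm]; exact Submodule.smul_mem _ _ hc

/-- Projecting to degree 2 replaces each cofactor by its component of degree 1. This is the source
of linearity of the resolution. -/
theorem mem_span_linear_mul {𝒜 : ℕ → Submodule k A} (hgm : SetLike.GradedMonoid 𝒜)
    (hint : DirectSum.IsInternal 𝒜) {x : σ → A} (hx : ∀ β, x β ∈ 𝒜 1) (S : Set σ) {a : A}
    (ha : a ∈ Ideal.span (x '' S)) (ha2 : a ∈ 𝒜 2) :
    a ∈ Submodule.span k {c | ∃ u ∈ 𝒜 1, ∃ β ∈ S, c = u * x β} := by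
  let := hint.chooseDecomposition
  let : GradedRing 𝒜 := { hgm with }
  have key : ∀ b ∈ Submodule.span k {c | ∃ u : A, ∃ β ∈ S, c = u * x β},
      (DirectSum.decompose 𝒜 b 2 : A) ∈
        Submodule.span k {c | ∃ u ∈ 𝒜 1, ∃ β ∈ S, c = u * x β} := by
    intro b hb
    induction hb using Submodule.span_induction with
    | mem c hc =>
      obtain ⟨u, β, hβ, rfl⟩ := hc
      refine Submodule.subset_span ⟨DirectSum.decompose 𝒜 u 1, SetLike.coe_mem _, β, hβ, ?_⟩
      exact DirectSum.coe_decompose_mul_add_of_right_mem 𝒜 (i := 1) (j := 1) (hx β)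
    | zero => simp
    | add c d _ _ hc hd =>
      rw [DirectSum.decompose_add]
      exact Submodule.add_mem _ hc hd
    | smul t c _ hc =>
      rw [DirectSum.decompose_smul]
      exact Submodule.smul_mem _ t hc
  have := key a (mem_span_mul_of_mem_ideal_span x S ha)
  rwa [DirectSum.decompose_of_mem_same 𝒜 ha2] at this

namespace LinearSyzygies

variable {𝒜 : ℕ → Submodule k A} {x : σ → A} {F : Set (Set σ)} (L : LinearSyzygies 𝒜 x F)

/-- The index set of the generators of `Z`. -/
abbrev Next : Type := Σ c : L.ι, L.label c

/-- A generator of `Z` with leading coefficient `x β`. -/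
noncomputable def generator (e : L.Next) : L.ι →₀ A :=
  (L.exists_lead e.1 e.2.1 e.2.2).choose

theorem generator_mem (e : L.Next) : L.generator e ∈ L.Z :=
  (L.exists_lead e.1 e.2.1 e.2.2).choose_spec.1

theorem generator_eq_zero (e : L.Next) (c : L.ι) (h : L.rank e.1 < L.rank c) :
    L.generator e c = 0 :=
  (L.exists_lead e.1 e.2.1 e.2.2).choose_spec.2.1 c h

theorem generator_lead (e : L.Next) : L.generator e e.1 = x e.2.1 :=
  (L.exists_lead e.1 e.2.1 e.2.2).choose_spec.2.2.1

theorem generator_coeff_mem (e : L.Next) (c : L.ι) : L.generator e c ∈ 𝒜 1 :=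
  (L.exists_lead e.1 e.2.1 e.2.2).choose_spec.2.2.2 c

/-- The differential. -/
noncomputable def diff : (L.Next →₀ A) →ₗ[A] (L.ι →₀ A) :=
  Finsupp.linearCombination A L.generator

theorem diff_single (e : L.Next) (a : A) : L.diff (Finsupp.single e a) = a • L.generator e :=
  Finsupp.linearCombination_single A a e

theorem diff_mem (a : L.Next →₀ A) : L.diff a ∈ L.Z := by
  rw [diff, Finsupp.linearCombination_apply]
  exact Submodule.sum_mem _ fun e _ => L.Z.smul_mem _ (L.generator_mem e)

/-- The pair `U`, `W` is `⊤`, `⊤` for generation of `Z`, and `𝒜 1`, `𝒜 2` for linearity of the next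
generators. -/
theorem diff_coeff_mem {U W : Submodule k A} (hUW : ∀ u ∈ U, ∀ v ∈ 𝒜 1, u * v ∈ W)
    (a : L.Next →₀ A) (ha : ∀ e, a e ∈ U) (c : L.ι) : L.diff a c ∈ W := by
  rw [diff, Finsupp.linearCombination_apply, Finsupp.sum, Finsupp.finsetSum_apply]
  exact Submodule.sum_mem _ fun e _ => hUW _ (ha e) _ (L.generator_coeff_mem e c)

theorem diff_eq_zero_of_rank {a : L.Next →₀ A} {m : ℕ}
    (ha : ∀ e, m < L.rank e.1 → a e = 0) (c : L.ι) (hc : m < L.rank c) : L.diff a c = 0 := by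
  rw [diff, Finsupp.linearCombination_apply, Finsupp.sum, Finsupp.finsetSum_apply]
  refine Finset.sum_eq_zero fun e _ => ?_
  rw [Finsupp.smul_apply]
  by_cases h : m < L.rank e.1
  · rw [ha e h, zero_smul]
  · rw [L.generator_eq_zero e c (by omega), smul_zero]

/-- An element of the ideal generated by linear forms in `label c` is the coefficient at
`c` of a combination of generators with leading term at `c`. -/
theorem exists_lift (U : Submodule k A) (c : L.ι) (S : Set σ) (hS : S ⊆ L.label c) {a : A}
    (ha : a ∈ Submodule.span k {d | ∃ u ∈ U, ∃ β ∈ S, d = u * x β}) :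
    ∃ b : L.Next →₀ A, (∀ e, b e ∈ U) ∧ (∀ e, b e ≠ 0 → e.1 = c ∧ e.2.1 ∈ S) ∧
      L.diff b c = a := by
  induction ha using Submodule.span_induction with
  | mem d hd =>
    obtain ⟨u, hu, β, hβ, rfl⟩ := hd
    refine ⟨Finsupp.single ⟨c, β, hS hβ⟩ u, ?_, ?_, ?_⟩
    · intro e
      rw [Finsupp.single_apply]
      split_ifs
      · exact hu
      · exact U.zero_mem
    · intro e he
      rw [Finsupp.single_apply] at he
      split_ifs at he with h
      · subst h
        exact ⟨rfl, hβ⟩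
      · exact absurd rfl he
    · rw [diff_single, Finsupp.smul_apply, smul_eq_mul]
      exact congrArg (u * ·) (L.generator_lead ⟨c, β, hS hβ⟩)
  | zero => exact ⟨0, fun _ => U.zero_mem, by simp, by simp⟩
  | add d d' _ _ hd hd' =>
    obtain ⟨b, h1, h2, h3⟩ := hd
    obtain ⟨b', h1', h2', h3'⟩ := hd'
    refine ⟨b + b', fun e => U.add_mem (h1 e) (h1' e), fun e he => ?_, by simp [h3, h3']⟩
    by_cases h : b e = 0
    · exact h2' e fun h' => he (by simp [h, h'])
    · exact h2 e h
  | smul t d _ hd =>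
    obtain ⟨b, h1, h2, h3⟩ := hd
    refine ⟨algebraMap k A t • b, fun e => ?_, fun e he => h2 e fun h => he (by simp [h]), ?_⟩
    · rw [Finsupp.smul_apply, smul_eq_mul, ← Algebra.smul_def]
      exact U.smul_mem _ (h1 e)
    · rw [map_smul, Finsupp.smul_apply, h3, smul_eq_mul, ← Algebra.smul_def]

/-- The elements of `Z` are combinations of the generators, with control on the
coefficients. -/
theorem exists_combination {U W : Submodule k A} (hUW : ∀ u ∈ U, ∀ v ∈ 𝒜 1, u * v ∈ W)
    (hlift : ∀ (S : Set σ) (a : A), a ∈ Ideal.span (x '' S) → a ∈ W →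
      a ∈ Submodule.span k {d | ∃ u ∈ U, ∃ β ∈ S, d = u * x β}) (m : ℕ) (z : L.ι →₀ A)
    (hz : z ∈ L.Z) (hzm : ∀ c, m ≤ L.rank c → z c = 0) (hzW : ∀ c, z c ∈ W) :
    ∃ a : L.Next →₀ A, (∀ e, a e ∈ U) ∧ (∀ e, m ≤ L.rank e.1 → a e = 0) ∧ L.diff a = z := by
  induction m generalizing z with
  | zero =>
    refine ⟨0, fun _ => U.zero_mem, fun _ _ => rfl, ?_⟩
    rw [map_zero]
    ext c
    exact (hzm c (Nat.zero_le _)).symm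
  | succ m ih =>
    by_cases hc : ∃ c, L.rank c = m
    · obtain ⟨c, rfl⟩ := hc
      have hlead := L.lead_mem z hz c fun c' h => hzm c' h
      -- The top coefficient is cancelled by generators leading at `c`, as in division with
      -- remainder; the difference has smaller rank.
      obtain ⟨b, hbU, hb, hbc⟩ :=
        L.exists_lift U c (L.label c) subset_rfl (hlift _ _ hlead (hzW c))
      have hb0 : ∀ e, L.rank c < L.rank e.1 → b e = 0 := by
        intro e he
        by_contra h
        rw [(hb e h).1] at he
        exact lt_irrefl _ he
      obtain ⟨a, haU, ha, haz⟩ := ih (z - L.diff b) (L.Z.sub_mem hz (L.diff_mem b)) (by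
        intro c' hc'
        rw [Finsupp.sub_apply]
        rcases hc'.eq_or_lt with h | h
        · rw [← L.injective h, hbc, sub_self]
        · rw [hzm c' h, L.diff_eq_zero_of_rank hb0 c' h, sub_self]) (by
        intro c'
        exact W.sub_mem (hzW c') (L.diff_coeff_mem hUW b hbU c'))
      refine ⟨a + b, fun e => U.add_mem (haU e) (hbU e), fun e he => ?_, ?_⟩
      · rw [Finsupp.add_apply, ha e (Nat.le_of_succ_le he), hb0 e he, add_zero]
      · rw [map_add, haz, sub_add_cancel]
    · obtain ⟨a, haU, ha, haz⟩ := ih z hz (fun c' h => by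
        rcases h.eq_or_lt with h | h
        · exact absurd ⟨c', h.symm⟩ hc
        · exact hzm c' h) hzW
      exact ⟨a, haU, fun e he => ha e (Nat.le_of_succ_le he), haz⟩

theorem range_diff : LinearMap.range L.diff = L.Z := by
  apply le_antisymm
  · rintro _ ⟨a, rfl⟩
    exact L.diff_mem a
  · intro z hz
    obtain ⟨a, -, -, ha⟩ := L.exists_combination (U := (⊤ : Submodule k A)) (W := ⊤)
      (fun _ _ _ _ => trivial)
      (fun S a ha _ => by simpa using mem_span_mul_of_mem_ideal_span (k := k) x S ha)
      (z.support.sup L.rank + 1) z hz (fun c hc => by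
        by_contra h
        have := Finset.le_sup (f := L.rank) (Finsupp.mem_support_iff.2 h)
        omega) (fun _ => trivial)
    exact ⟨a, ha⟩

/-- The rank of the generators of `Z`. -/
def nextRank (rk : σ → ℕ) (N : ℕ) (e : L.Next) : ℕ :=
  L.rank e.1 * N + rk e.2.1

theorem nextRank_lt_iff {rk : σ → ℕ} {N : ℕ} (hN : ∀ β, rk β < N) (e e' : L.Next) :
    L.nextRank rk N e < L.nextRank rk N e' ↔
      L.rank e.1 < L.rank e'.1 ∨ L.rank e.1 = L.rank e'.1 ∧ rk e.2.1 < rk e'.2.1 := by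
  have h1 := hN e.2.1
  have h2 := hN e'.2.1
  unfold nextRank
  rcases lt_trichotomy (L.rank e.1) (L.rank e'.1) with h | h | h
  · have := Nat.mul_le_mul_right N (Nat.succ_le_of_lt h)
    rw [Nat.succ_mul] at this
    simp only [h, true_or, iff_true]
    omega
  · rw [h]
    simp
  · have := Nat.mul_le_mul_right N (Nat.succ_le_of_lt h)
    rw [Nat.succ_mul] at this
    simp only [h.not_gt, h.ne', false_and, or_false, iff_false]
    omega

theorem nextRank_injective {rk : σ → ℕ} (hrk : Function.Injective rk) {N : ℕ}
    (hN : ∀ β, rk β < N) : Function.Injective (L.nextRank rk N) := by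
  intro e e' h
  have h1 := (L.nextRank_lt_iff hN e e').not.1 h.not_lt
  have h2 := (L.nextRank_lt_iff hN e' e).not.1 h.not_gt
  have h3 : e.1 = e'.1 := L.injective (by omega)
  have h4 : e.2.1 = e'.2.1 := hrk (by have := congrArg L.rank h3; omega)
  obtain ⟨c, β, hβ⟩ := e
  obtain ⟨c', β', hβ'⟩ := e'
  dsimp only at h3 h4
  subst h3 h4
  rfl

/-- Let a syzygy among the generators lead at (c, β). Its coordinate at c says that the leading
coefficient times `x β` lies in the ideal of the earlier forms of `label c`. So leading coefficients
form the colon ideal of the filtration, generated by another member of `F`. -/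
theorem exists_next {rk : σ → ℕ} {N : ℕ} (hN : ∀ β, rk β < N)
    (hF : KoszulFiltration 𝒜 x rk F) (hgm : SetLike.GradedMonoid 𝒜)
    (hint : DirectSum.IsInternal 𝒜) :
    ∃ (L' : LinearSyzygies 𝒜 x F) (d : (L'.ι →₀ A) →ₗ[A] (L.ι →₀ A)),
      (∀ e c, d (Finsupp.single e 1) c ∈ 𝒜 1) ∧ LinearMap.range d = L.Z ∧
      LinearMap.ker d = L'.Z := by
  choose T hTF hT using fun e : L.Next => hF.colon (L.label e.1) (L.label_mem e.1) e.2.1 e.2.2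
  refine ⟨⟨L.Next, L.nextRank rk N, L.nextRank_injective hF.injective hN, T, hTF,
    LinearMap.ker L.diff, ?_, ?_⟩, L.diff, ?_, L.range_diff, rfl⟩
  · intro z hz e he
    rw [← hT e]
    set J := Ideal.span (x '' {β | β ∈ L.label e.1 ∧ rk β < rk e.2.1}) with hJ
    have h0 : L.diff z e.1 = 0 := by
      rw [LinearMap.mem_ker.1 hz]; rfl
    have hsplit : z = Finsupp.single e (z e) + z.erase e := (Finsupp.single_add_erase e z).symm
    have hrest : L.diff (z.erase e) e.1 ∈ J := by
      rw [diff, Finsupp.linearCombination_apply, Finsupp.sum, Finsupp.finsetSum_apply]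
      refine Submodule.sum_mem _ fun e' he' => ?_
      rw [Finsupp.support_erase, Finset.mem_erase] at he'
      rw [Finsupp.erase_ne he'.1, Finsupp.smul_apply, smul_eq_mul]
      have hnot : ¬ L.nextRank rk N e < L.nextRank rk N e' := fun h =>
        Finsupp.mem_support_iff.1 he'.2 (he e' h)
      rw [L.nextRank_lt_iff hN] at hnot
      have hne : L.nextRank rk N e' ≠ L.nextRank rk N e := fun h =>
        he'.1 (L.nextRank_injective hF.injective hN h)
      rcases lt_or_ge (L.rank e'.1) (L.rank e.1) with h | h
      · rw [L.generator_eq_zero e' e.1 h, mul_zero]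
        exact J.zero_mem
      · have hr : L.rank e'.1 = L.rank e.1 := by omega
        have hc : e'.1 = e.1 := L.injective hr
        rw [← hc, L.generator_lead]
        refine J.mul_mem_left _ (Ideal.subset_span ⟨e'.2.1, ⟨hc ▸ e'.2.2, ?_⟩, rfl⟩)
        have : rk e'.2.1 ≠ rk e.2.1 := fun h' => hne (by unfold nextRank; rw [hr, h'])
        omega
    rw [hsplit, map_add, diff_single, Finsupp.add_apply, Finsupp.smul_apply, generator_lead,
      smul_eq_mul] at h0
    rw [eq_neg_of_add_eq_zero_left h0]
    exact J.neg_mem hrest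
  · intro e γ hγ
    have hlin : x γ * x e.2.1 ∈ Submodule.span k {d | ∃ u ∈ 𝒜 1,
        ∃ β ∈ {β | β ∈ L.label e.1 ∧ rk β < rk e.2.1}, d = u * x β} :=
      mem_span_linear_mul hgm hint hF.mem_one _
        ((hT e (x γ)).2 (Ideal.subset_span ⟨γ, hγ, rfl⟩))
        (hgm.mul_mem (hF.mem_one γ) (hF.mem_one _))
    obtain ⟨b, hb1, hb, hbc⟩ := L.exists_lift (𝒜 1) e.1 _ (fun β hβ => hβ.1) hlin
    set s : L.Next →₀ A := Finsupp.single e (x γ) with hs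
    have hs1 : ∀ e', s e' ∈ 𝒜 1 := by
      intro e'
      rw [hs, Finsupp.single_apply]
      split_ifs
      · exact hF.mem_one γ
      · exact Submodule.zero_mem _
    have hs0 : ∀ e', e' ≠ e → s e' = 0 := fun e' h => by
      rw [hs, Finsupp.single_eq_of_ne h]
    have hsb1 : ∀ e', (s - b) e' ∈ 𝒜 1 := fun e' => Submodule.sub_mem _ (hs1 e') (hb1 e')
    have hsb0 : ∀ e' : L.Next, L.rank e.1 < L.rank e'.1 → (s - b) e' = 0 := by
      intro e' he'
      have h1 : s e' = 0 := hs0 e' fun h => by rw [h] at he'; exact lt_irrefl _ he'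
      have h2 : b e' = 0 := by
        by_contra h
        rw [(hb e' h).1] at he'
        exact lt_irrefl _ he'
      rw [Finsupp.sub_apply, h1, h2, sub_self]
    have h11 : ∀ u ∈ 𝒜 1, ∀ v ∈ 𝒜 1, u * v ∈ 𝒜 2 := fun u hu v hv => hgm.mul_mem hu hv
    obtain ⟨a, ha1, ha, had⟩ := L.exists_combination h11
      (fun S a h h' => mem_span_linear_mul hgm hint hF.mem_one S h h') (L.rank e.1)
      (L.diff (s - b)) (L.diff_mem _) (by
        intro c hc
        rcases hc.eq_or_lt with h | h
        · rw [← L.injective h, map_sub, Finsupp.sub_apply, hbc, hs, diff_single,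
            Finsupp.smul_apply, generator_lead, smul_eq_mul, sub_self]
        · exact L.diff_eq_zero_of_rank hsb0 c h)
      (L.diff_coeff_mem h11 _ hsb1)
    have hbe : b e = 0 := by
      by_contra h
      exact lt_irrefl _ (hb e h).2.2
    -- `s` is the wanted leading term, `b` cancels the image of `s` at `e.1` by earlier generators
    -- there, and `a` cancels what remains in lower rank.
    refine ⟨s - b - a, ?_, ?_, ?_, ?_⟩
    · rw [LinearMap.mem_ker, map_sub, had, sub_self]
    · intro e' he'
      have he'' := (L.nextRank_lt_iff hN _ _).1 he'
      have h1 : s e' = 0 := hs0 e' fun h => by rw [h] at he'; exact lt_irrefl _ he'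
      have h2 : b e' = 0 := by
        by_contra h
        have := (hb e' h).2.2
        have h3 := congrArg L.rank (hb e' h).1
        omega
      have h3 : a e' = 0 := ha e' (by omega)
      rw [Finsupp.sub_apply, Finsupp.sub_apply, h1, h2, h3]
      simp
    · rw [Finsupp.sub_apply, Finsupp.sub_apply, hbe, ha e le_rfl, hs]
      simp
    · intro e'
      exact Submodule.sub_mem _ (hsb1 e') (ha1 e')
  · intro e c
    rw [diff_single, one_smul]
    exact L.generator_coeff_mem e c

end LinearSyzygies

/-- An algebra with a Koszul filtration containing the maximal homogeneous ideal is Koszul. -/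
theorem KoszulFiltration.hasLinearResolution {A : Type} [CommRing A] [Algebra k A]
    {𝒜 : ℕ → Submodule k A} {x : σ → A} [Finite σ] {rk : σ → ℕ} {F : Set (Set σ)}
    (hF : KoszulFiltration 𝒜 x rk F) (huniv : Set.univ ∈ F)
    (hgm : SetLike.GradedMonoid 𝒜) (hint : DirectSum.IsInternal 𝒜)
    (hmax : ∀ a, a ∈ ⨆ m : ℕ, 𝒜 (m + 1) ↔ a ∈ Ideal.span (Set.range x)) :
    HasLinearResolution k 𝒜 := by
  obtain ⟨N, hN⟩ : ∃ N, ∀ β, rk β < N := by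
    obtain ⟨M, hM⟩ := (Set.finite_range rk).bddAbove
    exact ⟨M + 1, fun β => Nat.lt_succ_of_le (hM ⟨β, rfl⟩)⟩
  let Z : Submodule A (Unit →₀ A) :=
    Submodule.comap (Finsupp.lapply ()) (Ideal.span (Set.range x))
  -- The induction starts with the augmentation ideal inside `A`, whose leading ideal is generated
  -- by all the forms.
  let L₀ : LinearSyzygies 𝒜 x F :=
    { ι := Unit
      rank := fun _ => 0
      injective := fun _ _ _ => rfl
      label := fun _ => Set.univ
      label_mem := fun _ => huniv
      Z := Z
      lead_mem := fun z hz c _ => by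
        rw [Set.image_univ]
        exact hz
      exists_lead := fun c β _ => ⟨Finsupp.single () (x β), by
        change Finsupp.single () (x β) () ∈ Ideal.span (Set.range x)
        rw [Finsupp.single_eq_same]
        exact Ideal.subset_span (Set.mem_range_self β), fun c' h => absurd h (lt_irrefl _), by
        rw [Finsupp.single_eq_same], fun c' => by
        rw [Finsupp.single_eq_same]; exact hF.mem_one β⟩ }
  choose next d hd1 hd2 hd3 using
    fun L : LinearSyzygies 𝒜 x F => L.exists_next hN hF hgm hint
  let L : ℕ → LinearSyzygies 𝒜 x F := fun i => Nat.rec L₀ (fun _ M => next M) i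
  refine ⟨fun i => (L i).ι, fun i => d (L i), ⟨inferInstanceAs (Unique Unit)⟩,
    fun i => hd1 (L i), ?_, fun i => ?_⟩
  · intro p
    change p ∈ LinearMap.range (d L₀) ↔ _
    rw [hd2 L₀]
    constructor
    · intro h j
      exact (hmax _).2 h
    · intro h
      exact (hmax _).1 (h ())
  · rw [hd2, hd3]

end KoszulFiltration

end GradedAlg

/-! ### Quadratic relations with pairwise disjoint leading terms -/

/-- A family of quadratic relations `r l` in variables which have levels. The middle term of `r l` is
the product of two variables `p l`, `q l` of the same level, and all other terms are products of
a variable of a smaller and a variable of a greater level. Two variables are incomparable in the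
weak order only if they are the variables of a middle term. -/
structure MiddleTerms (k : Type*) [Field k] (σ Λ : Type*) where
  level : σ → ℤ
  loop : σ → Prop
  p : Λ → σ
  q : Λ → σ
  r : Λ → MvPolynomial σ k
  level_eq : ∀ l, level (p l) = level (q l)
  level_injective : ∀ l l', level (p l) = level (p l') → l = l'
  loop_of_eq : ∀ l, p l = q l → loop (p l)
  exists_middle : ∀ α β, level α = level β → (α = β → loop α) →
    ∃ l, (α = p l ∧ β = q l) ∨ (α = q l ∧ β = p l)
  r_sub_mem : ∀ l, r l - MvPolynomial.X (p l) * MvPolynomial.X (q l) ∈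
    Submodule.span k {P | ∃ γ δ, level γ < level (p l) ∧ level (p l) < level δ ∧
      level γ + level δ = 2 * level (p l) ∧ P = MvPolynomial.X γ * MvPolynomial.X δ}

namespace MiddleTerms

open MvPolynomial
open scoped Classical

variable {k : Type*} [Field k] {σ Λ : Type*} (D : MiddleTerms k σ Λ)

/-- The weak order. -/
def wle (α β : σ) : Prop :=
  D.level α < D.level β ∨ (α = β ∧ ¬ D.loop α)

/-- The exponent of the middle term. -/
noncomputable def middle (l : Λ) : σ →₀ ℕ :=
  Finsupp.single (D.p l) 1 + Finsupp.single (D.q l) 1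

/-- Exponents of monomials that are not divisible by a middle term. -/
def Standard (e : σ →₀ ℕ) : Prop :=
  ∀ l, ¬ D.middle l ≤ e

/-- The common value is 2 for a square and 1 otherwise, which lets both cases be treated together.
-/
theorem middle_p_eq_middle_q (l : Λ) : D.middle l (D.p l) = D.middle l (D.q l) := by
  by_cases h : D.p l = D.q l
  · rw [h]
  · simp [middle, h, Ne.symm h]

theorem middle_pos (l : Λ) : 0 < D.middle l (D.p l) := by
  simp [middle]

theorem middle_apply_of_ne {l : Λ} {α : σ} (hp : α ≠ D.p l) (hq : α ≠ D.q l) :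
    D.middle l α = 0 := by
  simp [middle, hp.symm, hq.symm]

theorem middle_le_iff (l : Λ) (e : σ →₀ ℕ) :
    D.middle l ≤ e ↔ D.middle l (D.p l) ≤ e (D.p l) ∧ D.middle l (D.p l) ≤ e (D.q l) := by
  constructor
  · intro h
    exact ⟨h _, D.middle_p_eq_middle_q l ▸ h _⟩
  · rintro ⟨h1, h2⟩ α
    by_cases hp : α = D.p l
    · rw [hp]; exact h1
    by_cases hq : α = D.q l
    · rw [hq, ← D.middle_p_eq_middle_q]; exact h2
    rw [D.middle_apply_of_ne hp hq]
    exact Nat.zero_le _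

theorem middle_apply_of_level_ne {l : Λ} {α : σ} (h : D.level α ≠ D.level (D.p l)) :
    D.middle l α = 0 :=
  D.middle_apply_of_ne (fun h' => h (h' ▸ rfl)) fun h' => h (h' ▸ (D.level_eq l).symm)

/-- The exponent of the leading term of `X ^ u * ∏ r l ^ a l`. -/
noncomputable def leadExp (j : {u // D.Standard u} × (Λ →₀ ℕ)) : σ →₀ ℕ :=
  j.1.1 + ∑ l ∈ j.2.support, j.2 l • D.middle l

/-- Middle terms of different relations live on different levels, so only one summand contributes.
-/
theorem sum_middle_apply (a : Λ →₀ ℕ) (l : Λ) {α : σ} (h : D.level α = D.level (D.p l)) :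
    (∑ l ∈ a.support, a l • D.middle l) α = a l * D.middle l α := by
  rw [Finsupp.finsetSum_apply, Finset.sum_eq_single l]
  · simp
  · intro l' _ hl'
    rw [Finsupp.smul_apply, D.middle_apply_of_level_ne, smul_zero]
    intro h'
    exact hl' (D.level_injective _ _ (h'.symm.trans h))
  · intro hl
    simp [Finsupp.notMem_support_iff.1 hl]

/-- If `a l > a' l`, comparing the exponents of `p l` and `q l` shows that `middle l` divides the
standard part `u'`, which is impossible. -/
theorem leadExp_injective : Function.Injective D.leadExp := by
  have key : ∀ j j', D.leadExp j = D.leadExp j' → ∀ l, j.2 l ≤ j'.2 l := by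
    rintro ⟨⟨u, hu⟩, a⟩ ⟨⟨u', hu'⟩, a'⟩ h l
    have hp := DFunLike.congr_fun h (D.p l)
    have hq := DFunLike.congr_fun h (D.q l)
    simp only [leadExp, Finsupp.add_apply] at hp hq
    rw [D.sum_middle_apply _ l rfl, D.sum_middle_apply _ l rfl] at hp
    rw [D.sum_middle_apply _ l (D.level_eq l).symm, D.sum_middle_apply _ l (D.level_eq l).symm,
      ← D.middle_p_eq_middle_q] at hq
    have hs := hu' l
    rw [D.middle_le_iff] at hs
    by_contra hlt
    have := Nat.mul_le_mul_right (D.middle l (D.p l)) (Nat.succ_le_of_lt (not_le.1 hlt))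
    rw [Nat.succ_mul] at this
    dsimp only at this
    exact hs ⟨by omega, by omega⟩
  intro j j' h
  have ha : j.2 = j'.2 := Finsupp.ext fun l => le_antisymm (key _ _ h l) (key _ _ h.symm l)
  have hu : j.1.1 = j'.1.1 := by
    rw [leadExp, leadExp, ha] at h
    exact add_right_cancel h
  exact Prod.ext (Subtype.ext hu) ha

theorem sum_middle_add_single (a : Λ →₀ ℕ) (l : Λ) :
    ∑ l' ∈ (a + Finsupp.single l 1 : Λ →₀ ℕ).support, (a + Finsupp.single l 1 : Λ →₀ ℕ) l' • D.middle l' =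
      ∑ l' ∈ a.support, a l' • D.middle l' + D.middle l := by
  change (a + Finsupp.single l 1 : Λ →₀ ℕ).sum (fun l' n => n • D.middle l') =
    a.sum (fun l' n => n • D.middle l') + D.middle l
  rw [Finsupp.sum_add_index' (by simp) (by intros; rw [add_smul]), Finsupp.sum_single_index]
  · rw [one_smul]
  · rw [zero_smul]

theorem leadExp_surjective : Function.Surjective D.leadExp := by
  intro e
  induction hd : e.degree using Nat.strong_induction_on generalizing e with
  | _ d ih =>
    subst hd
    by_cases he : D.Standard e
    · exact ⟨⟨⟨e, he⟩, 0⟩, by simp [leadExp]⟩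
    · obtain ⟨l, hl⟩ : ∃ l, D.middle l ≤ e := by simpa [Standard] using he
      obtain ⟨e', rfl⟩ := exists_add_of_le hl
      obtain ⟨⟨u, a⟩, hj⟩ := ih e'.degree (by simp [middle]) e' rfl
      refine ⟨⟨u, a + Finsupp.single l 1⟩, ?_⟩
      rw [← hj]
      simp only [leadExp, D.sum_middle_add_single]
      abel

theorem monomial_single_add_single (γ δ : σ) :
    monomial (Finsupp.single γ 1 + Finsupp.single δ 1) (1 : k) = X γ * X δ := by
  simp [X, monomial_mul]

/-- The products of standard monomials and relations. -/
noncomputable def basisElem (j : {u // D.Standard u} × (Λ →₀ ℕ)) : MvPolynomial σ k :=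
  monomial j.1.1 1 * ∏ l ∈ j.2.support, D.r l ^ j.2 l

theorem basisElem_mul_r (j : {u // D.Standard u} × (Λ →₀ ℕ)) (l : Λ) :
    D.basisElem j * D.r l = D.basisElem ⟨j.1, j.2 + Finsupp.single l 1⟩ := by
  have : ∏ l' ∈ (j.2 + Finsupp.single l 1 : Λ →₀ ℕ).support,
      D.r l' ^ (j.2 + Finsupp.single l 1 : Λ →₀ ℕ) l' = (∏ l' ∈ j.2.support, D.r l' ^ j.2 l') * D.r l := by
    change (j.2 + Finsupp.single l 1 : Λ →₀ ℕ).prod (fun l' n => D.r l' ^ n) =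
      j.2.prod (fun l' n => D.r l' ^ n) * D.r l
    rw [Finsupp.prod_add_index' (by simp) (by intros; rw [pow_add]), Finsupp.prod_single_index]
    · rw [pow_one]
    · rw [pow_zero]
  rw [basisElem, basisElem, this, mul_assoc]

/-! ### Leading terms and independence of the standard monomials -/

section Weight

/-- A weight for which the middle terms are the leading terms. -/
noncomputable def weight [Fintype σ] : (σ →₀ ℕ) →+ ℕ :=
  Finsupp.weight fun α => ∑ β, (D.level β).natAbs ^ 2 - (D.level α).natAbs ^ 2

variable [Fintype σ]

/-- Strict convexity of the square at fixed sum. The sum over all variables bounds each square, so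
the natural subtraction in `weight` does not truncate. -/
theorem weight_lt {γ δ : σ} {l : Λ} (h : D.level γ < D.level (D.p l))
    (hs : D.level γ + D.level δ = 2 * D.level (D.p l)) :
    D.weight (Finsupp.single γ 1 + Finsupp.single δ 1) < D.weight (D.middle l) := by
  have hle : ∀ α, (D.level α).natAbs ^ 2 ≤ ∑ β, (D.level β).natAbs ^ 2 := fun α =>
    Finset.single_le_sum (f := fun β => (D.level β).natAbs ^ 2) (fun _ _ => Nat.zero_le _)
      (Finset.mem_univ α)
  have hlt : 2 * (D.level (D.p l)).natAbs ^ 2 <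
      (D.level γ).natAbs ^ 2 + (D.level δ).natAbs ^ 2 := by
    zify
    simp only [sq_abs]
    have hδ : D.level δ = 2 * D.level (D.p l) - D.level γ := by omega
    rw [hδ]
    nlinarith [mul_pos (sub_pos.2 h) (sub_pos.2 h)]
  have h1 := hle γ
  have h2 := hle δ
  have h3 := hle (D.p l)
  have h4 := congrArg Int.natAbs (D.level_eq l)
  simp only [weight, middle, map_add, Finsupp.weight_single, one_smul, ← h4]
  omega

/-- The polynomials whose monomials have weight less than `n`. -/
noncomputable def below (n : ℕ) : Submodule k (MvPolynomial σ k) :=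
  Submodule.span k {P | ∃ e, D.weight e < n ∧ P = monomial e 1}

theorem monomial_mem_below {e : σ →₀ ℕ} {n : ℕ} (h : D.weight e < n) :
    monomial e (1 : k) ∈ D.below n :=
  Submodule.subset_span ⟨e, h, rfl⟩

theorem below_mono {m n : ℕ} (h : m ≤ n) : D.below m ≤ D.below n :=
  Submodule.span_mono fun _ ⟨e, he, hP⟩ => ⟨e, he.trans_le h, hP⟩

theorem mul_mem_below {m n : ℕ} {P Q : MvPolynomial σ k} (hP : P ∈ D.below m)
    (hQ : Q ∈ D.below (n + 1)) : P * Q ∈ D.below (m + n) := by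
  have h : D.below m * D.below (n + 1) ≤ D.below (m + n) := by
    rw [below, below, Submodule.span_mul_span, Submodule.span_le]
    rintro _ ⟨_, ⟨e, he, rfl⟩, _, ⟨e', he', rfl⟩, rfl⟩
    refine Submodule.subset_span ⟨e + e', ?_, by simp [monomial_mul]⟩
    rw [map_add]
    omega
  exact h (Submodule.mul_mem_mul hP hQ)

theorem coeff_eq_zero_of_mem_below {n : ℕ} {P : MvPolynomial σ k} (hP : P ∈ D.below n)
    {e : σ →₀ ℕ} (he : n ≤ D.weight e) : coeff e P = 0 := by
  induction hP using Submodule.span_induction with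
  | mem P hP =>
    obtain ⟨e', he', rfl⟩ := hP
    rw [coeff_monomial, if_neg]
    rintro rfl
    omega
  | zero => simp
  | add P Q _ _ h h' => rw [coeff_add, h, h', add_zero]
  | smul c P _ h => rw [coeff_smul, h, smul_zero]

/-- `X ^ e` is the leading term of `P`. -/
def Lead (P : MvPolynomial σ k) (e : σ →₀ ℕ) : Prop :=
  P - monomial e 1 ∈ D.below (D.weight e)

variable {D}

theorem Lead.mem_below {P : MvPolynomial σ k} {e : σ →₀ ℕ} (h : D.Lead P e) :
    P ∈ D.below (D.weight e + 1) := by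
  have := (D.below _).add_mem (D.below_mono (Nat.le_succ _) h)
    (D.monomial_mem_below (Nat.lt_succ_self (D.weight e)))
  simpa using this

theorem lead_monomial (e : σ →₀ ℕ) : D.Lead (monomial e 1) e := by
  rw [Lead, sub_self]
  exact Submodule.zero_mem _

theorem Lead.mul {P Q : MvPolynomial σ k} {e e' : σ →₀ ℕ} (h : D.Lead P e) (h' : D.Lead Q e') :
    D.Lead (P * Q) (e + e') := by
  have h1 := D.mul_mem_below h h'.mem_below
  have h2 := D.mul_mem_below h' (D.monomial_mem_below (Nat.lt_succ_self (D.weight e)))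
  rw [add_comm] at h2
  have := (D.below _).add_mem h1 h2
  rw [Lead, map_add]
  convert! this using 1
  have : monomial (e + e') (1 : k) = monomial e 1 * monomial e' 1 := by simp [monomial_mul]
  rw [this]
  ring

theorem Lead.pow {P : MvPolynomial σ k} {e : σ →₀ ℕ} (h : D.Lead P e) (n : ℕ) :
    D.Lead (P ^ n) (n • e) := by
  induction n with
  | zero => simpa using lead_monomial (D := D) 0
  | succ n ih =>
    rw [pow_succ, succ_nsmul]
    exact ih.mul h

theorem Lead.prod {ι : Type*} {s : Finset ι} {P : ι → MvPolynomial σ k} {e : ι → σ →₀ ℕ}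
    (h : ∀ i ∈ s, D.Lead (P i) (e i)) : D.Lead (∏ i ∈ s, P i) (∑ i ∈ s, e i) := by
  induction s using Finset.induction_on with
  | empty => simpa using lead_monomial (D := D) 0
  | insert a s ha ih =>
    rw [Finset.prod_insert ha, Finset.sum_insert ha]
    exact (h a (Finset.mem_insert_self _ _)).mul
      (ih fun i hi => h i (Finset.mem_insert_of_mem hi))

theorem lead_r (l : Λ) : D.Lead (D.r l) (D.middle l) := by
  rw [Lead, middle, monomial_single_add_single]
  refine (Submodule.span_le.2 ?_) (D.r_sub_mem l)
  rintro _ ⟨γ, δ, h, -, hs, rfl⟩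
  rw [← monomial_single_add_single]
  exact D.monomial_mem_below (D.weight_lt h hs)

variable (D)

theorem lead_basisElem (j : {u // D.Standard u} × (Λ →₀ ℕ)) :
    D.Lead (D.basisElem j) (D.leadExp j) :=
  (lead_monomial _).mul (Lead.prod fun l _ => (lead_r l).pow _)

/-- At an index of maximal weight, other elements of the same weight have different leading
exponents, so its leading coefficient cannot cancel. -/
theorem linearIndependent_basisElem : LinearIndependent k D.basisElem := by
  rw [linearIndependent_iff]
  intro c hc
  by_contra h0
  obtain ⟨j, hj, hmax⟩ := Finset.exists_max_image c.support (fun j => D.weight (D.leadExp j))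
    (Finsupp.support_nonempty_iff.2 h0)
  have hcoeff := congrArg (coeff (D.leadExp j)) hc
  rw [Finsupp.linearCombination_apply, Finsupp.sum, coeff_sum, Finset.sum_eq_single j] at hcoeff
  · have h1 := D.coeff_eq_zero_of_mem_below (D.lead_basisElem j) le_rfl
    rw [coeff_sub, coeff_monomial, if_pos rfl, sub_eq_zero] at h1
    rw [coeff_smul, h1, coeff_zero, smul_eq_mul, mul_one] at hcoeff
    exact Finsupp.mem_support_iff.1 hj hcoeff
  · intro j' hj' hne
    have h1 := D.coeff_eq_zero_of_mem_below (D.lead_basisElem j') (hmax j' hj')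
    rw [coeff_sub, coeff_monomial, if_neg fun h => hne (D.leadExp_injective h), sub_zero] at h1
    rw [coeff_smul, h1, smul_zero]
  · intro h
    exact absurd hj h

theorem span_basisElem : Submodule.span k (Set.range D.basisElem) = ⊤ := by
  have hmon : ∀ e, monomial e (1 : k) ∈ Submodule.span k (Set.range D.basisElem) := by
    intro e
    induction hd : D.weight e using Nat.strong_induction_on generalizing e with
    | _ d ih =>
      subst hd
      obtain ⟨j, rfl⟩ := D.leadExp_surjective e
      have h1 : D.basisElem j - monomial (D.leadExp j) 1 ∈
          Submodule.span k (Set.range D.basisElem) := by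
        refine (Submodule.span_le.2 ?_) (D.lead_basisElem j)
        rintro _ ⟨e, he, rfl⟩
        exact ih _ he e rfl
      have := Submodule.sub_mem _ (Submodule.subset_span (Set.mem_range_self j)) h1
      simpa using this
  rw [eq_top_iff]
  intro P _
  rw [P.as_sum]
  refine Submodule.sum_mem _ fun e _ => ?_
  have := Submodule.smul_mem _ (coeff e P) (hmon e)
  rwa [smul_monomial, smul_eq_mul, mul_one] at this

/-- Multiplying a basis element by `r l` only raises the exponent of `r l`, so the ideal is spanned
by basis elements. -/
theorem mul_r_mem_span (u : MvPolynomial σ k) (l : Λ) :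
    u * D.r l ∈ Submodule.span k (D.basisElem '' {j | j.2 ≠ 0}) := by
  have hu : u ∈ Submodule.span k (Set.range D.basisElem) := D.span_basisElem ▸ Submodule.mem_top
  induction hu using Submodule.span_induction with
  | mem u hu =>
    obtain ⟨j, rfl⟩ := hu
    rw [D.basisElem_mul_r]
    refine Submodule.subset_span (Set.mem_image_of_mem _ ?_)
    intro h
    have := DFunLike.congr_fun h l
    simp at this
  | zero => rw [zero_mul]; exact Submodule.zero_mem _
  | add u v _ _ h h' => rw [add_mul]; exact Submodule.add_mem _ h h'
  | smul c u _ h => rw [smul_mul_assoc]; exact Submodule.smul_mem _ _ h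

theorem mem_span_of_mem_ideal {P : MvPolynomial σ k} (hP : P ∈ Ideal.span (Set.range D.r)) :
    P ∈ Submodule.span k (D.basisElem '' {j | j.2 ≠ 0}) := by
  rw [← Set.image_univ] at hP
  have h := GradedAlg.mem_span_mul_of_mem_ideal_span (k := k) D.r _ hP
  refine (Submodule.span_le (p := Submodule.span k (D.basisElem '' {j | j.2 ≠ 0})).2 ?_) h
  rintro _ ⟨u, l, -, rfl⟩
  exact D.mul_r_mem_span u l

/-- The quotient by the relations. -/
abbrev Alg : Type _ := MvPolynomial σ k ⧸ Ideal.span (Set.range D.r)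

/-- The classes of the monomials. -/
noncomputable def mon (e : σ →₀ ℕ) : MvPolynomial σ k ⧸ Ideal.span (Set.range D.r) :=
  Ideal.Quotient.mk _ (monomial e 1)

/-- The standard monomials are linearly independent modulo the relations. -/
theorem linearIndependent_standard :
    LinearIndependent k fun u : {u // D.Standard u} => D.mon u.1 := by
  have h1 : LinearIndependent k fun u : {u // D.Standard u} => D.basisElem ⟨u, 0⟩ :=
    D.linearIndependent_basisElem.comp (fun u => (u, 0)) fun u v h => (Prod.ext_iff.1 h).1
  have h2 := h1.map (f := (Ideal.Quotient.mkₐ k (Ideal.span (Set.range D.r))).toLinearMap) (by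
    have hd := D.linearIndependent_basisElem.disjoint_span_image
      (s := Set.range fun u : {u // D.Standard u} => (u, (0 : Λ →₀ ℕ))) (t := {j | j.2 ≠ 0}) (by
        rw [Set.disjoint_left]
        rintro _ ⟨u, rfl⟩ h
        exact h rfl)
    rw [← Set.range_comp] at hd
    refine hd.mono_right fun P hP => D.mem_span_of_mem_ideal ?_
    exact Ideal.Quotient.eq_zero_iff_mem.1 hP)
  convert! h2 using 2 with u
  simp [basisElem, mon]

end Weight

end MiddleTerms

/-! ### Normal forms and colon ideals in the quotient -/

namespace MiddleTerms

open MvPolynomial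
open scoped Classical

section Quotient

variable {k : Type*} [Field k] {σ Λ : Type*} (D : MiddleTerms k σ Λ)

/-- The classes of the variables. -/
noncomputable def gen (α : σ) : D.Alg :=
  Ideal.Quotient.mk _ (X α)

theorem mon_zero : D.mon 0 = 1 := by
  simp [mon]

theorem mon_add (e e' : σ →₀ ℕ) : D.mon (e + e') = D.mon e * D.mon e' := by
  rw [mon, mon, mon, ← map_mul, monomial_mul, one_mul]

theorem gen_eq_mon (α : σ) : D.gen α = D.mon (Finsupp.single α 1) := rfl

theorem span_mon : Submodule.span k (Set.range D.mon) = ⊤ := by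
  rw [eq_top_iff]
  intro a _
  obtain ⟨P, rfl⟩ := Ideal.Quotient.mk_surjective a
  rw [P.as_sum, map_sum]
  refine Submodule.sum_mem _ fun e _ => ?_
  have := Submodule.smul_mem _ (coeff e P)
    (Submodule.subset_span (R := k) (Set.mem_range_self (f := D.mon) e))
  convert! this using 1
  rw [mon, ← Ideal.Quotient.mkₐ_eq_mk k, ← map_smul, smul_monomial, smul_eq_mul, mul_one]

/-- The relations express the middle terms through the other terms. -/
theorem mon_middle_mem (l : Λ) : D.mon (D.middle l) ∈
    Submodule.span k {a | ∃ γ δ, D.level γ < D.level (D.p l) ∧ D.level (D.p l) < D.level δ ∧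
      D.level γ + D.level δ = 2 * D.level (D.p l) ∧
      a = D.mon (Finsupp.single γ 1 + Finsupp.single δ 1)} := by
  have h := Submodule.mem_map_of_mem
    (f := (Ideal.Quotient.mkₐ k (Ideal.span (Set.range D.r))).toLinearMap) (D.r_sub_mem l)
  rw [map_sub, Submodule.map_span] at h
  have hr : (Ideal.Quotient.mkₐ k (Ideal.span (Set.range D.r))).toLinearMap (D.r l) = 0 :=
    Ideal.Quotient.eq_zero_iff_mem.2 (Ideal.subset_span (Set.mem_range_self l))
  rw [hr, zero_sub, ← monomial_single_add_single] at h
  have h' := (Submodule.neg_mem_iff _).1 h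
  refine (Submodule.span_mono ?_) h'
  rintro _ ⟨_, ⟨γ, δ, h1, h2, h3, rfl⟩, rfl⟩
  refine ⟨γ, δ, h1, h2, h3, ?_⟩
  rw [← monomial_single_add_single]
  rfl

/-- The reduction to standard monomials; it respects properties of monomials which are preserved
when a middle term is replaced by other terms of the relation. -/
theorem mon_mem_span [Fintype σ] (Q : (σ →₀ ℕ) → Prop)
    (hQ : ∀ e l γ δ, Q (D.middle l + e) → D.level γ < D.level (D.p l) →
      D.level (D.p l) < D.level δ → Q (Finsupp.single γ 1 + Finsupp.single δ 1 + e))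
    (e : σ →₀ ℕ) (he : Q e) :
    D.mon e ∈ Submodule.span k (D.mon '' {u | D.Standard u ∧ Q u}) := by
  induction hd : D.weight e using Nat.strong_induction_on generalizing e with
  | _ d ih =>
    subst hd
    by_cases hs : D.Standard e
    · exact Submodule.subset_span (Set.mem_image_of_mem _ ⟨hs, he⟩)
    · obtain ⟨l, hl⟩ : ∃ l, D.middle l ≤ e := by simpa [Standard] using hs
      obtain ⟨e', rfl⟩ := exists_add_of_le hl
      rw [D.mon_add]
      have hm := D.mon_middle_mem l
      generalize D.mon (D.middle l) = b at hm
      induction hm using Submodule.span_induction with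
      | mem a ha =>
        obtain ⟨γ, δ, h1, h2, h3, rfl⟩ := ha
        rw [← D.mon_add]
        refine ih _ ?_ _ (hQ _ _ _ _ he h1 h2) rfl
        rw [map_add D.weight _ e', map_add D.weight _ e']
        exact Nat.add_lt_add_right (D.weight_lt h1 h3) _
      | zero => rw [zero_mul]; exact Submodule.zero_mem _
      | add a b _ _ h h' => rw [add_mul]; exact Submodule.add_mem _ h h'
      | smul c a _ h => rw [smul_mul_assoc]; exact Submodule.smul_mem _ _ h

theorem span_standard [Fintype σ] :
    Submodule.span k (D.mon '' {u | D.Standard u}) = ⊤ := by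
  rw [eq_top_iff, ← D.span_mon, Submodule.span_le]
  rintro _ ⟨e, rfl⟩
  simpa using D.mon_mem_span (fun _ => True) (fun _ _ _ _ _ _ _ => trivial) e trivial

/-- Sets of variables which contain all variables of greater level. -/
def IsUpper (S : Set σ) : Prop :=
  ∀ β ∈ S, ∀ γ, D.level β < D.level γ → γ ∈ S

/-- Reduction preserves the occurrence of a variable of `S`: if it is lost with a middle term, the
new factor of greater level is again in `S`. -/
theorem ideal_span_le [Fintype σ] {S : Set σ} (hS : D.IsUpper S) {a : D.Alg}
    (ha : a ∈ Ideal.span (D.gen '' S)) :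
    a ∈ Submodule.span k (D.mon '' {u | D.Standard u ∧ ∃ β ∈ S, u β ≠ 0}) := by
  have h := GradedAlg.mem_span_mul_of_mem_ideal_span (k := k) D.gen S ha
  refine (Submodule.span_le (p := Submodule.span k (D.mon '' _)).2 ?_) h
  rintro _ ⟨u, β, hβ, rfl⟩
  have hu : u ∈ Submodule.span k (Set.range D.mon) := D.span_mon ▸ Submodule.mem_top
  rw [SetLike.mem_coe]
  induction hu using Submodule.span_induction with
  | mem u hu =>
    obtain ⟨e, rfl⟩ := hu
    rw [gen_eq_mon, ← D.mon_add]
    refine D.mon_mem_span (fun u => ∃ β ∈ S, u β ≠ 0) ?_ _ ⟨β, hβ, by simp⟩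
    rintro e l γ δ ⟨β, hβ, hβe⟩ - h2
    by_cases h : e β = 0
    · refine ⟨δ, hS β hβ δ ?_, by simp⟩
      rw [Finsupp.add_apply, h, add_zero] at hβe
      rwa [not_imp_comm.1 D.middle_apply_of_level_ne hβe]
    · exact ⟨β, hβ, by simp [h]⟩
  | zero => rw [zero_mul]; exact Submodule.zero_mem _
  | add u v _ _ h h' => rw [add_mul]; exact Submodule.add_mem _ h h'
  | smul c u _ h => rw [smul_mul_assoc]; exact Submodule.smul_mem _ _ h

theorem not_wle_p_q (l : Λ) : ¬ D.wle (D.p l) (D.q l) := by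
  rintro (h | ⟨h, h'⟩)
  · exact h.ne (D.level_eq l)
  · exact h' (D.loop_of_eq l h)

theorem not_wle_q_p (l : Λ) : ¬ D.wle (D.q l) (D.p l) := by
  rintro (h | ⟨h, h'⟩)
  · exact h.ne' (D.level_eq l)
  · exact h' (h ▸ D.loop_of_eq l h.symm)

theorem standard_zero : D.Standard 0 := by
  intro l h
  have := D.middle_pos l
  have h' := h (D.p l)
  simp at h'
  omega

/-- A new middle term would have to pair `α` with a variable already in `u`, but the two factors of
a middle term are incomparable. -/
theorem standard_add_single {u : σ →₀ ℕ} (hu : D.Standard u) {α : σ}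
    (h : ∀ β, u β ≠ 0 → D.wle β α) : D.Standard (u + Finsupp.single α 1) := by
  intro l hl
  have hul := hu l
  by_cases hpq : D.p l = D.q l
  · have h1 := hl (D.p l)
    have h2 : D.middle l (D.p l) = 2 := by simp [middle, ← hpq]
    rw [h2, Finsupp.add_apply] at h1
    by_cases hα : α = D.p l
    · subst hα
      rw [Finsupp.single_eq_same] at h1
      have := h (D.p l) (by omega)
      exact D.not_wle_p_q l (hpq ▸ this)
    · rw [Finsupp.single_eq_of_ne (Ne.symm hα), add_zero] at h1
      refine hul ((D.middle_le_iff l u).2 ?_)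
      rw [h2, ← hpq]
      exact ⟨h1, h1⟩
  · have h1 := hl (D.p l)
    have h1' := hl (D.q l)
    have h2 : D.middle l (D.p l) = 1 := by simp [middle, hpq]
    rw [Finsupp.add_apply] at h1 h1'
    rw [← D.middle_p_eq_middle_q] at h1'
    rw [h2] at h1 h1'
    by_cases hα : α = D.p l
    · subst hα
      rw [Finsupp.single_eq_of_ne (Ne.symm hpq)] at h1'
      exact D.not_wle_q_p l (h _ (by omega))
    by_cases hα' : α = D.q l
    · subst hα'
      rw [Finsupp.single_eq_of_ne hpq] at h1
      exact D.not_wle_p_q l (h _ (by omega))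
    · rw [Finsupp.single_eq_of_ne (Ne.symm hα)] at h1
      rw [Finsupp.single_eq_of_ne (Ne.symm hα')] at h1'
      refine hul ((D.middle_le_iff l u).2 ?_)
      rw [h2]
      exact ⟨h1, h1'⟩

theorem standard_pair {α β : σ} (h : D.wle α β) :
    D.Standard (Finsupp.single α 1 + Finsupp.single β 1) := by
  have h1 : D.Standard (Finsupp.single α 1) := by
    have := D.standard_add_single D.standard_zero (α := α) (by simp)
    rwa [zero_add] at this
  refine D.standard_add_single h1 fun γ hγ => ?_
  rw [Finsupp.single_apply_ne_zero] at hγ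
  rw [hγ.1]
  exact h

theorem exists_middle_of_not_wle {α β : σ} (h : ¬ D.wle α β) (h' : ¬ D.wle β α) :
    ∃ l, D.level α = D.level (D.p l) ∧
      Finsupp.single α 1 + Finsupp.single β 1 = D.middle l := by
  simp only [wle, not_or, not_and, not_not] at h h'
  obtain ⟨l, ⟨rfl, rfl⟩ | ⟨rfl, rfl⟩⟩ := D.exists_middle α β (by omega) h.2
  · exact ⟨l, rfl, rfl⟩
  · exact ⟨l, (D.level_eq l).symm, add_comm _ _⟩

theorem level_le_of_wle {α β : σ} (h : D.wle α β) : D.level α ≤ D.level β := by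
  rcases h with h | ⟨rfl, -⟩
  · exact h.le
  · exact le_rfl

/-- The span of monomials over disjoint sets of standard exponents. -/
theorem disjoint_span [Fintype σ] {U V : Set (σ →₀ ℕ)} (hU : ∀ u ∈ U, D.Standard u)
    (hV : ∀ u ∈ V, D.Standard u) (h : Disjoint U V) :
    Disjoint (Submodule.span k (D.mon '' U)) (Submodule.span k (D.mon '' V)) := by
  have himage : ∀ U : Set (σ →₀ ℕ), (∀ u ∈ U, D.Standard u) →
      (fun u : {u // D.Standard u} => D.mon u.1) '' {u | u.1 ∈ U} = D.mon '' U := by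
    intro U hU
    ext a
    constructor
    · rintro ⟨u, hu, rfl⟩
      exact ⟨u.1, hu, rfl⟩
    · rintro ⟨u, hu, rfl⟩
      exact ⟨⟨u, hU u hu⟩, hu, rfl⟩
  have := D.linearIndependent_standard.disjoint_span_image (s := {u | u.1 ∈ U})
    (t := {u | u.1 ∈ V}) (Set.disjoint_left.2 fun u h1 h2 => Set.disjoint_left.1 h h1 h2)
  rwa [himage U hU, himage V hV] at this

/-- Multiplication by `gen α` sends the standard monomials in variables weakly below `α` injectively
to standard monomials without variables of `S`, while the ideal is spanned by standard monomials
with one. -/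
theorem eq_zero_of_mul_gen_mem [Fintype σ] {S : Set σ} (hS : D.IsUpper S) {α : σ}
    (hα : α ∉ S) (hwle : ∀ β ∈ S, ¬ D.wle β α) {a : D.Alg}
    (ha : a ∈ Submodule.span k (D.mon '' {u | D.Standard u ∧ ∀ β, u β ≠ 0 → D.wle β α}))
    (h : a * D.gen α ∈ Ideal.span (D.gen '' S)) : a = 0 := by
  set U : Set (σ →₀ ℕ) := {u | D.Standard u ∧ ∀ β, u β ≠ 0 → D.wle β α} with hU
  set T : Set (σ →₀ ℕ) := (fun u => u + Finsupp.single α 1) '' U with hT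
  have hTstd : ∀ u ∈ T, D.Standard u := by
    rintro _ ⟨u, hu, rfl⟩
    exact D.standard_add_single hu.1 hu.2
  have h1 : a * D.gen α ∈ Submodule.span k (D.mon '' T) := by
    have := Submodule.mem_map_of_mem (f := LinearMap.mulRight k (D.gen α)) ha
    rw [Submodule.map_span, LinearMap.mulRight_apply] at this
    refine Submodule.span_mono ?_ this
    rintro _ ⟨_, ⟨u, hu, rfl⟩, rfl⟩
    refine ⟨_, Set.mem_image_of_mem _ hu, ?_⟩
    rw [D.mon_add]
    rfl
  have h2 := D.ideal_span_le hS h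
  have hdisj : Disjoint T {u | D.Standard u ∧ ∃ β ∈ S, u β ≠ 0} := by
    rw [Set.disjoint_left]
    rintro _ ⟨u, hu, rfl⟩ ⟨-, β, hβ, hne⟩
    have hβα : β ≠ α := fun h => hα (h ▸ hβ)
    dsimp only at hne
    rw [Finsupp.add_apply, Finsupp.single_eq_of_ne hβα, add_zero] at hne
    exact hwle β hβ (hu.2 β hne)
  have h3 : a * D.gen α = 0 := by
    have := (D.disjoint_span hTstd (fun u hu => hu.1) hdisj).le_bot ⟨h1, h2⟩
    simpa using this
  rw [Set.image_eq_range] at ha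
  obtain ⟨c, rfl⟩ := Finsupp.mem_span_range_iff_exists_finsupp.1 ha
  have hind : LinearIndependent k fun u : U => D.mon (u.1 + Finsupp.single α 1) :=
    D.linearIndependent_standard.comp
      (fun u : U => ⟨u.1 + Finsupp.single α 1, D.standard_add_single u.2.1 u.2.2⟩)
      fun u v h => Subtype.ext (add_right_cancel (Subtype.ext_iff.1 h))
  have hc : c = 0 := by
    apply linearIndependent_iff.1 hind
    rw [Finsupp.linearCombination_apply, ← h3, Finsupp.sum, Finsupp.sum, Finset.sum_mul]
    refine Finset.sum_congr rfl fun u _ => ?_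
    rw [D.mon_add, smul_mul_assoc, gen_eq_mon]
  rw [hc, Finsupp.sum_zero_index]

/-- The upper sets of variables form a Koszul filtration. -/
theorem colon [Fintype σ] {rk : σ → ℕ}
    (hlev : ∀ α β, D.level α < D.level β → rk β < rk α) {S : Set σ} (hS : D.IsUpper S) {α : σ}
    (hα : α ∈ S) (a : D.Alg) :
    a * D.gen α ∈ Ideal.span (D.gen '' {β | β ∈ S ∧ rk β < rk α}) ↔
      a ∈ Ideal.span (D.gen '' {β | ¬ D.wle β α}) := by
  set S' : Set σ := {β | β ∈ S ∧ rk β < rk α} with hS'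
  set T : Set σ := {β | ¬ D.wle β α} with hT
  have hgreater : ∀ δ, D.level α < D.level δ → D.gen δ ∈ Ideal.span (D.gen '' S') := fun δ h =>
    Ideal.subset_span (Set.mem_image_of_mem _ ⟨hS α hα δ h, hlev _ _ h⟩)
  have hback : ∀ a ∈ Ideal.span (D.gen '' T), a * D.gen α ∈ Ideal.span (D.gen '' S') := by
    intro a ha
    have hle : Ideal.span (D.gen '' T) ≤
        Submodule.comap (LinearMap.mulRight D.Alg (D.gen α)) (Ideal.span (D.gen '' S')) := by
      refine Submodule.span_le.2 ?_
      rintro _ ⟨β, hβ, rfl⟩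
      change D.gen β * D.gen α ∈ Ideal.span (D.gen '' S')
      rcases lt_or_ge (D.level α) (D.level β) with h | h
      · exact Ideal.mul_mem_right _ _ (hgreater β h)
      have hβα : ¬ D.wle β α := hβ
      have hαβ : ¬ D.wle α β := by
        rintro (h' | ⟨rfl, h'⟩)
        · omega
        · exact hβα (Or.inr ⟨rfl, h'⟩)
      -- The product is a middle term, and each term replacing it has a factor of level greater than
      -- that of `α`, hence in `S'`.
      obtain ⟨l, hl, hm⟩ := D.exists_middle_of_not_wle hαβ hβα
      rw [mul_comm, gen_eq_mon, gen_eq_mon, ← D.mon_add, hm]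
      refine (Submodule.span_le
        (p := (Ideal.span (D.gen '' S')).restrictScalars k).2 ?_) (D.mon_middle_mem l)
      rintro _ ⟨γ, δ, -, h2, -, rfl⟩
      rw [D.mon_add]
      exact Ideal.mul_mem_left _ _ (hgreater δ (hl ▸ h2))
    exact hle ha
  refine ⟨fun h => ?_, hback a⟩
  have hupper : D.IsUpper S' := fun β hβ γ h => ⟨hS β hβ.1 γ h, (hlev _ _ h).trans hβ.2⟩
  have hmem : a ∈ Submodule.span k (D.mon '' {u | D.Standard u}) :=
    D.span_standard ▸ Submodule.mem_top
  -- Modulo the ideal of `T` only standard monomials in variables weakly below `α` remain.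
  have hsub : D.mon '' {u | D.Standard u} ⊆
      D.mon '' {u | D.Standard u ∧ ∀ β, u β ≠ 0 → D.wle β α} ∪
        (Ideal.span (D.gen '' T) : Set D.Alg) := by
    rintro _ ⟨u, hu, rfl⟩
    by_cases hall : ∀ β, u β ≠ 0 → D.wle β α
    · exact Or.inl ⟨u, ⟨hu, hall⟩, rfl⟩
    · right
      push Not at hall
      obtain ⟨β, hβ, hβα⟩ := hall
      obtain ⟨v, rfl⟩ := exists_add_of_le (Finsupp.single_le_iff.2 (Nat.one_le_iff_ne_zero.2 hβ))
      rw [D.mon_add]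
      exact Ideal.mul_mem_right _ _ (Ideal.subset_span (Set.mem_image_of_mem D.gen hβα))
  have hmem' := Submodule.span_mono (R := k) hsub hmem
  rw [Submodule.span_union] at hmem'
  obtain ⟨a₁, ha₁, a₂, ha₂, rfl⟩ := Submodule.mem_sup.1 hmem'
  have ha₂' : a₂ ∈ Ideal.span (D.gen '' T) :=
    (Submodule.span_le (p := (Ideal.span (D.gen '' T)).restrictScalars k).2 subset_rfl) ha₂
  have h0 : a₁ = 0 := by
    refine D.eq_zero_of_mul_gen_mem hupper (fun h => lt_irrefl _ h.2) ?_ ha₁ ?_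
    · rintro β ⟨-, hβ⟩ (h' | ⟨rfl, -⟩)
      · exact lt_asymm hβ (hlev _ _ h')
      · exact lt_irrefl _ hβ
    · have := Ideal.sub_mem _ h (hback a₂ ha₂')
      rwa [add_mul, add_sub_cancel_right] at this
  rw [h0, zero_add]
  exact ha₂'

end Quotient

end MiddleTerms

/-! ### PBW pairs and PBW words -/

namespace MiddleTerms

open MvPolynomial
open scoped Classical

section Words

variable {k : Type*} [Field k] {σ Λ : Type*} (D : MiddleTerms k σ Λ)

theorem gen_mul_gen (α β : σ) :
    D.gen α * D.gen β = D.mon (Finsupp.single α 1 + Finsupp.single β 1) := by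
  rw [D.mon_add]
  rfl

theorem single_add_single_eq_iff {α β γ δ : σ} :
    (Finsupp.single α 1 + Finsupp.single β 1 : σ →₀ ℕ) =
      Finsupp.single γ 1 + Finsupp.single δ 1 ↔ (α = γ ∧ β = δ) ∨ (α = δ ∧ β = γ) := by
  rw [Finsupp.single_add_single_eq_single_add_single one_ne_zero one_ne_zero]
  simp

theorem not_lex_of_lt {lt : σ → σ → Prop} [IsStrictTotalOrder σ lt] {α β p q : σ}
    (h : lt α p) : ¬ Prod.Lex lt lt (p, q) (α, β) := by
  intro h'
  rcases Prod.lex_iff.1 h' with h' | ⟨h', -⟩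
  · exact asymm_of lt h h'
  · simp only at h'
    exact irrefl_of lt α (h' ▸ h)

/-- A comparable pair gives another standard monomial. A middle term expands into γδ with γ below
`p` in level; if this were αβ, then γ = α would precede `p`, against the lexicographic order. -/
theorem gen_mul_gen_mem_of_lex [Fintype σ] {lt : σ → σ → Prop} [IsStrictTotalOrder σ lt]
    (hlt : ∀ α β, D.level α < D.level β → lt α β) {α β p q : σ} (h : D.wle α β)
    (hlex : Prod.Lex lt lt (p, q) (α, β)) :
    D.gen p * D.gen q ∈ Submodule.span k (D.mon '' {u | D.Standard u ∧
      u ≠ Finsupp.single α 1 + Finsupp.single β 1}) := by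
  rw [D.gen_mul_gen]
  have hne : D.wle p q ∨ D.wle q p → Finsupp.single p 1 + Finsupp.single q 1 ≠
      Finsupp.single α 1 + Finsupp.single β 1 := by
    intro _ heq
    rcases single_add_single_eq_iff.1 heq with ⟨rfl, rfl⟩ | ⟨rfl, rfl⟩
    · rcases Prod.lex_iff.1 hlex with h' | ⟨-, h'⟩
      · exact irrefl_of lt _ h'
      · exact irrefl_of lt _ h'
    · rcases h with h | ⟨rfl, -⟩
      · exact not_lex_of_lt (hlt _ _ h) hlex
      · rcases Prod.lex_iff.1 hlex with h' | ⟨-, h'⟩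
        · exact irrefl_of lt _ h'
        · exact irrefl_of lt _ h'
  by_cases hpq : D.wle p q
  · exact Submodule.subset_span (Set.mem_image_of_mem _ ⟨D.standard_pair hpq, hne (Or.inl hpq)⟩)
  by_cases hqp : D.wle q p
  · refine Submodule.subset_span (Set.mem_image_of_mem _ ⟨?_, hne (Or.inr hqp)⟩)
    rw [add_comm]
    exact D.standard_pair hqp
  obtain ⟨l, hl, hm⟩ := D.exists_middle_of_not_wle hpq hqp
  rw [hm]
  refine (Submodule.span_mono ?_) (D.mon_middle_mem l)
  rintro _ ⟨γ, δ, h1, h2, -, rfl⟩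
  refine Set.mem_image_of_mem _ ⟨D.standard_pair (Or.inl (h1.trans h2)), fun heq => ?_⟩
  rcases single_add_single_eq_iff.1 heq with ⟨rfl, rfl⟩ | ⟨rfl, rfl⟩
  · exact not_lex_of_lt (hlt _ _ (hl ▸ h1)) hlex
  · have := D.level_le_of_wle h
    omega

/-- The PBW pairs are the pairs of the weak order. -/
theorem pbwPair_iff [Fintype σ] {lt : σ → σ → Prop} [IsStrictTotalOrder σ lt]
    (hlt : ∀ α β, D.level α < D.level β → lt α β) (α β : σ) : GradedAlg.PBWPair k lt D.gen α β ↔ D.wle α β := by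
  constructor
  · intro h
    by_contra hwle
    apply h
    by_cases hβα : D.level β < D.level α
    · refine Submodule.subset_span ⟨β, α, Prod.Lex.left _ _ (hlt _ _ hβα), mul_comm _ _⟩
    have hwle' : ¬ D.wle β α := by
      rintro (h' | ⟨rfl, h'⟩)
      · exact hβα h'
      · exact hwle (Or.inr ⟨rfl, h'⟩)
    obtain ⟨l, hl, hm⟩ := D.exists_middle_of_not_wle hwle hwle'
    rw [D.gen_mul_gen, hm]
    refine (Submodule.span_mono ?_) (D.mon_middle_mem l)
    rintro _ ⟨γ, δ, h1, -, -, rfl⟩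
    exact ⟨γ, δ, Prod.Lex.left _ _ (hlt _ _ (hl ▸ h1)), (D.gen_mul_gen γ δ).symm⟩
  · intro h hmem
    have hle : D.gen α * D.gen β ∈ Submodule.span k (D.mon '' {u | D.Standard u ∧
        u ≠ Finsupp.single α 1 + Finsupp.single β 1}) := by
      refine (Submodule.span_le (p := Submodule.span k (D.mon '' _)).2 ?_) hmem
      rintro _ ⟨p, q, hlex, rfl⟩
      exact D.gen_mul_gen_mem_of_lex hlt h hlex
    rw [D.gen_mul_gen] at hle
    have hstd := D.standard_pair h
    have himage : D.mon '' {u | D.Standard u ∧ u ≠ Finsupp.single α 1 + Finsupp.single β 1} =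
        (fun u : {u // D.Standard u} => D.mon u.1) ''
          {u | u.1 ≠ Finsupp.single α 1 + Finsupp.single β 1} := by
      ext a
      constructor
      · rintro ⟨u, hu, rfl⟩
        exact ⟨⟨u, hu.1⟩, hu.2, rfl⟩
      · rintro ⟨u, hu, rfl⟩
        exact ⟨u.1, ⟨u.2, hu⟩, rfl⟩
    rw [himage] at hle
    exact D.linearIndependent_standard.notMem_span_image
      (s := {u | u.1 ≠ Finsupp.single α 1 + Finsupp.single β 1})
      (x := ⟨_, hstd⟩) (fun h => h rfl) hle

theorem wle_trans {α β γ : σ} (h : D.wle α β) (h' : D.wle β γ) : D.wle α γ := by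
  rcases h with h | ⟨rfl, h⟩
  · exact Or.inl (h.trans_le (D.level_le_of_wle h'))
  · exact h'

/-- Transitivity of the weak order extends the condition from consecutive letters to all pairs. -/
theorem isPBWWord_iff [Fintype σ] {lt : σ → σ → Prop} [IsStrictTotalOrder σ lt]
    (hlt : ∀ α β, D.level α < D.level β → lt α β) (w : List σ) :
    GradedAlg.IsPBWWord k lt D.gen w ↔ w.Pairwise D.wle := by
  have : IsTrans σ D.wle := ⟨fun _ _ _ h h' => D.wle_trans h h'⟩
  rw [GradedAlg.IsPBWWord, ← List.isChain_iff_pairwise]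
  exact List.IsChain.iff (D.pbwPair_iff hlt)

theorem prod_word (w : List σ) :
    (w.map D.gen).prod = D.mon (Multiset.toFinsupp (w : Multiset σ)) := by
  induction w with
  | nil => simp [D.mon_zero]
  | cons α w ih =>
    rw [List.map_cons, List.prod_cons, ih, gen_eq_mon, ← D.mon_add, ← Multiset.cons_coe,
      ← Multiset.singleton_add, map_add, Multiset.toFinsupp_singleton]

theorem standard_word {w : List σ} (hw : w.Pairwise D.wle) :
    D.Standard (Multiset.toFinsupp (w : Multiset σ)) := by
  intro l hl
  have hcount : ∀ α, D.middle l α ≤ w.count α := fun α => by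
    simpa [Multiset.toFinsupp_apply] using hl α
  have hsub : [D.p l, D.q l].Subperm w := by
    rw [List.subperm_ext_iff]
    intro α _
    refine le_trans (le_of_eq ?_) (hcount α)
    simp only [middle, Finsupp.add_apply, Finsupp.single_apply, List.count_cons, List.count_nil,
      beq_iff_eq]
    ring
  obtain ⟨v, hv, hvw⟩ := hsub
  have hpair := hw.sublist hvw
  rcases List.perm_pair.1 hv with rfl | rfl
  · exact D.not_wle_p_q l (by simpa using hpair)
  · exact D.not_wle_q_p l (by simpa using hpair)

theorem linearIndependent_words [Fintype σ] {lt : σ → σ → Prop} [IsStrictTotalOrder σ lt]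
    (hlt : ∀ α β, D.level α < D.level β → lt α β) :
    LinearIndependent k (fun w : {w : List σ // GradedAlg.IsPBWWord k lt D.gen w} =>
      (w.1.map D.gen).prod) := by
  have hinj : Function.Injective
      (fun w : {w : List σ // GradedAlg.IsPBWWord k lt D.gen w} =>
        (⟨Multiset.toFinsupp (w.1 : Multiset σ),
          D.standard_word ((D.isPBWWord_iff hlt _).1 w.2)⟩ : {u // D.Standard u})) := by
    intro w w' h
    have hperm : w.1.Perm w'.1 :=
      Multiset.coe_eq_coe.1 (Multiset.toFinsupp.injective (Subtype.ext_iff.1 h))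
    refine Subtype.ext (hperm.eq_of_pairwise ?_ ((D.isPBWWord_iff hlt _).1 w.2)
      ((D.isPBWWord_iff hlt _).1 w'.2))
    rintro α β - - (h1 | ⟨rfl, -⟩) h2
    · exact absurd (D.level_le_of_wle h2) (by omega)
    · rfl
  have := D.linearIndependent_standard.comp _ hinj
  convert! this using 2 with w
  exact D.prod_word _

end Words

end MiddleTerms

/-! ### The grading; Koszul and PBW properties -/

namespace MiddleTerms

open MvPolynomial
open scoped Classical

section Grading

variable {k : Type*} [Field k] {σ Λ : Type*} (D : MiddleTerms k σ Λ)

/-- The grading by the degree in the variables. -/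
noncomputable def grad (d : ℕ) : Submodule k D.Alg :=
  (homogeneousSubmodule σ k d).map
    (Ideal.Quotient.mkₐ k (Ideal.span (Set.range D.r))).toLinearMap

theorem isHomogeneous_r (l : Λ) : (D.r l).IsHomogeneous 2 := by
  have hX : ∀ γ δ : σ, (X γ * X δ : MvPolynomial σ k) ∈ homogeneousSubmodule σ k 2 := fun γ δ =>
    (isHomogeneous_X k γ).mul (isHomogeneous_X k δ)
  have h : D.r l - X (D.p l) * X (D.q l) ∈ homogeneousSubmodule σ k 2 := by
    refine (Submodule.span_le.2 ?_) (D.r_sub_mem l)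
    rintro _ ⟨γ, δ, -, -, -, rfl⟩
    exact hX γ δ
  have := Submodule.add_mem _ h (hX (D.p l) (D.q l))
  rwa [sub_add_cancel] at this

theorem homogeneousComponent_mem {P : MvPolynomial σ k} (hP : P ∈ Ideal.span (Set.range D.r))
    (d : ℕ) : homogeneousComponent d P ∈ Ideal.span (Set.range D.r) := by
  let _ : GradedAlgebra (homogeneousSubmodule σ k) := gradedAlgebra
  have h : (Ideal.span (Set.range D.r)).IsHomogeneous (homogeneousSubmodule σ k) := by
    apply Ideal.homogeneous_span
    rintro _ ⟨l, rfl⟩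
    exact ⟨2, D.isHomogeneous_r l⟩
  exact (mem_iff_homogeneousComponent_mem h P).1 hP d

/-- The projection onto a homogeneous component. -/
noncomputable def component (d : ℕ) : D.Alg →ₗ[k] D.Alg :=
  Submodule.mapQ ((Ideal.span (Set.range D.r)).restrictScalars k)
    ((Ideal.span (Set.range D.r)).restrictScalars k) (homogeneousComponent d)
    fun _ hP => D.homogeneousComponent_mem hP d

theorem component_mk (d : ℕ) (P : MvPolynomial σ k) :
    D.component d (Ideal.Quotient.mk _ P) = Ideal.Quotient.mk _ (homogeneousComponent d P) := rfl

theorem gradedMonoid : SetLike.GradedMonoid D.grad where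
  one_mem := ⟨1, isHomogeneous_one σ k, map_one (Ideal.Quotient.mkₐ k _)⟩
  mul_mem := by
    rintro i j _ _ ⟨P, hP, rfl⟩ ⟨Q, hQ, rfl⟩
    exact ⟨P * Q, IsHomogeneous.mul hP hQ, map_mul (Ideal.Quotient.mkₐ k _) P Q⟩

theorem isInternal : DirectSum.IsInternal D.grad := by
  apply DirectSum.isInternal_submodule_of_iSupIndep_of_iSup_eq_top
  · rw [iSupIndep_def]
    intro d
    rw [Submodule.disjoint_def]
    rintro _ ⟨P, hP, rfl⟩ h
    have hker : ⨆ j, ⨆ (_ : j ≠ d), D.grad j ≤ LinearMap.ker (D.component d) := by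
      refine iSup₂_le fun j hj => ?_
      rintro _ ⟨Q, hQ, rfl⟩
      rw [LinearMap.mem_ker]
      refine (D.component_mk d Q).trans ?_
      rw [homogeneousComponent_of_mem hQ, if_neg (Ne.symm hj), map_zero]
    have h1 := LinearMap.mem_ker.1 (hker h)
    have h2 : D.component d (Ideal.Quotient.mk _ P) = Ideal.Quotient.mk _ P := by
      rw [D.component_mk, homogeneousComponent_of_mem hP, if_pos rfl]
    exact h2.symm.trans h1
  · rw [eq_top_iff, ← D.span_mon, Submodule.span_le]
    rintro _ ⟨e, rfl⟩
    exact Submodule.mem_iSup_of_mem e.degree ⟨monomial e 1, isHomogeneous_monomial _ rfl, rfl⟩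

theorem span_gen : Submodule.span k (Set.range D.gen) = D.grad 1 := by
  rw [grad, homogeneousSubmodule_one_eq_span_X, Submodule.map_span, ← Set.range_comp]
  rfl

theorem gen_mem (α : σ) : D.gen α ∈ D.grad 1 :=
  D.span_gen ▸ Submodule.subset_span (Set.mem_range_self α)

theorem grad_zero : D.grad 0 = 1 := by
  rw [grad, homogeneousSubmodule_zero]
  exact Submodule.map_one (Ideal.Quotient.mkₐ k (Ideal.span (Set.range D.r)))

theorem adjoin_grad_one : Algebra.adjoin k (D.grad 1 : Set D.Alg) = ⊤ := by
  have h : Algebra.adjoin k (Set.range D.gen) = ⊤ := by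
    have h1 := congrArg (Subalgebra.map (Ideal.Quotient.mkₐ k (Ideal.span (Set.range D.r))))
      (adjoin_range_X (R := k) (σ := σ))
    rw [AlgHom.map_adjoin, ← Set.range_comp, Algebra.map_top,
      (AlgHom.range_eq_top _).2 (Ideal.Quotient.mkₐ_surjective k _)] at h1
    exact h1
  rw [eq_top_iff, ← h]
  apply Algebra.adjoin_mono
  rw [← D.span_gen]
  exact Submodule.subset_span

theorem mem_iSup_grad_iff (a : D.Alg) :
    a ∈ ⨆ m : ℕ, D.grad (m + 1) ↔ a ∈ Ideal.span (Set.range D.gen) := by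
  constructor
  · intro ha
    refine (iSup_le (a := (Ideal.span (Set.range D.gen)).restrictScalars k) fun m => ?_) ha
    rintro _ ⟨P, hP, rfl⟩
    change Ideal.Quotient.mk _ P ∈ Ideal.span (Set.range D.gen)
    have hP' : P ∈ homogeneousSubmodule σ k 1 ^ m * homogeneousSubmodule σ k 1 := by
      rw [← pow_succ, homogeneousSubmodule_one_pow]
      exact hP
    clear hP
    induction hP' using Submodule.mul_induction_on' with
    | mem_mul_mem P _ Q hQ =>
      rw [homogeneousSubmodule_one_eq_span_X] at hQ
      have hQ' : Ideal.Quotient.mk (Ideal.span (Set.range D.r)) Q ∈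
          Ideal.span (Set.range D.gen) := by
        refine (Submodule.span_le (p := ((Ideal.span (Set.range D.gen)).restrictScalars k).comap
          (Ideal.Quotient.mkₐ k (Ideal.span (Set.range D.r))).toLinearMap).2 ?_) hQ
        rintro _ ⟨α, rfl⟩
        exact Ideal.subset_span (Set.mem_range_self α)
      have := Ideal.mul_mem_left _ (Ideal.Quotient.mk (Ideal.span (Set.range D.r)) P) hQ'
      rwa [← map_mul] at this
    | add P _ Q _ h h' =>
      rw [map_add]
      exact Submodule.add_mem _ h h'
  · intro ha
    have h := GradedAlg.mem_span_mul_of_mem_ideal_span (k := k) D.gen Set.univ (a := a)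
      (by rwa [Set.image_univ (f := D.gen)])
    refine (Submodule.span_le (p := ⨆ m : ℕ, D.grad (m + 1)).2 ?_) h
    rintro _ ⟨u, α, -, rfl⟩
    rw [SetLike.mem_coe]
    have hu : u ∈ Submodule.span k (Set.range D.mon) := D.span_mon ▸ Submodule.mem_top
    induction hu using Submodule.span_induction with
    | mem u hu =>
      obtain ⟨e, rfl⟩ := hu
      refine Submodule.mem_iSup_of_mem e.degree (D.gradedMonoid.mul_mem ?_ (D.gen_mem α))
      exact ⟨monomial e 1, isHomogeneous_monomial _ rfl, rfl⟩
    | zero => rw [zero_mul]; exact Submodule.zero_mem _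
    | add u v _ _ h h' => rw [add_mul]; exact Submodule.add_mem _ h h'
    | smul c u _ h => rw [smul_mul_assoc]; exact Submodule.smul_mem _ _ h

variable [Fintype σ]

theorem linearIndependent_gen : LinearIndependent k D.gen := by
  have hstd : ∀ α, D.Standard (Finsupp.single α 1) := fun α => by
    have := D.standard_add_single D.standard_zero (α := α) (by simp)
    rwa [zero_add] at this
  exact D.linearIndependent_standard.comp (fun α => ⟨_, hstd α⟩)
    fun α β h => Finsupp.single_left_injective one_ne_zero (Subtype.ext_iff.1 h)

theorem algebraMap_injective : Function.Injective (algebraMap k D.Alg) := by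
  have h := D.linearIndependent_standard.ne_zero ⟨0, D.standard_zero⟩
  rw [D.mon_zero] at h
  have : Nontrivial D.Alg := ⟨1, 0, h⟩
  exact (algebraMap k D.Alg).injective

theorem isPBW {lt : σ → σ → Prop} [IsStrictTotalOrder σ lt]
    (hlt : ∀ α β, D.level α < D.level β → lt α β) : GradedAlg.IsPBW k D.grad lt D.gen :=
  GradedAlg.isPBW_of_linearIndependent D.gradedMonoid D.isInternal D.algebraMap_injective
    D.grad_zero D.adjoin_grad_one D.linearIndependent_gen D.span_gen
    (D.linearIndependent_words hlt)

/-- Koszulness mentions no order, but its proof needs one; ties within a level are broken by an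
enumeration. -/
theorem exists_total_order : ∃ lt : σ → σ → Prop, IsStrictTotalOrder σ lt ∧
    ∀ α β, D.level α < D.level β → lt α β := by
  let f : σ ↪ ℤ ×ₗ Fin (Fintype.card σ) :=
    ⟨fun α => toLex (D.level α, Fintype.equivFin σ α), fun α β h =>
      (Fintype.equivFin σ).injective (Prod.ext_iff.1 (toLex.injective h)).2⟩
  exact ⟨f ⁻¹'o (· < ·), (RelEmbedding.preimage f (· < ·)).isStrictTotalOrder,
    fun α β h => Prod.Lex.left _ _ h⟩

end Grading

theorem isKoszul {k σ : Type} {Λ : Type*} [Field k] [Fintype σ] (D : MiddleTerms k σ Λ) :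
    GradedAlg.IsKoszul k D.grad := by
  obtain ⟨lt, hto, hlt⟩ := D.exists_total_order
  refine ⟨(D.isPBW hlt).isQuadratic, ?_⟩
  -- The order is reversed because variables of greater level must be divided out first.
  have : IsStrictTotalOrder σ (Function.swap lt) := inferInstance
  obtain ⟨rk, -, hrk, -⟩ := GradedAlg.exists_rank (Function.swap lt)
  have hinj : Function.Injective rk := by
    intro α β h
    rcases trichotomous_of lt α β with h' | h' | h'
    · exact absurd (hrk β α h') (by omega)
    · exact h'
    · exact absurd (hrk α β h') (by omega)
  have hF : GradedAlg.KoszulFiltration D.grad D.gen rk {S | D.IsUpper S} :=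
    ⟨hinj, D.gen_mem, fun S hS α hα => ⟨{β | ¬ D.wle β α}, fun β hβ γ h h' => by
      rcases h' with h' | ⟨rfl, -⟩
      · exact hβ (Or.inl (h.trans h'))
      · exact hβ (Or.inl h),
      D.colon (fun α β h => hrk β α (hlt α β h)) hS hα⟩⟩
  exact hF.hasLinearResolution (fun _ _ _ _ => trivial) D.gradedMonoid D.isInternal
    D.mem_iSup_grad_iff

theorem isKoszul_and_isPBW {k σ : Type} {Λ : Type*} [Field k] [Fintype σ]
    (D : MiddleTerms k σ Λ) {I : Ideal (MvPolynomial σ k)} (hI : I = Ideal.span (Set.range D.r)) :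
    GradedAlg.IsKoszul k (fun d => (homogeneousSubmodule σ k d).map
      (Ideal.Quotient.mkₐ k I).toLinearMap) ∧
    ∀ lt : σ → σ → Prop, IsStrictTotalOrder σ lt → (∀ α β, D.level α < D.level β → lt α β) →
      GradedAlg.IsPBW k (fun d => (homogeneousSubmodule σ k d).map
        (Ideal.Quotient.mkₐ k I).toLinearMap) lt (fun α => Ideal.Quotient.mk I (X α)) ∧
      ∀ w : List σ, GradedAlg.IsPBWWord k lt (fun α => Ideal.Quotient.mk I (X α)) w ↔
        w.Pairwise D.wle := by
  subst hI
  exact ⟨D.isKoszul, fun lt _ hlt => ⟨D.isPBW hlt, D.isPBWWord_iff hlt⟩⟩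

end MiddleTerms

/-! ### The middle terms of the quadric relations -/

namespace OddQuadric

open MvPolynomial

variable {n N₁ N₂ : ℕ}

noncomputable instance : Fintype (Gen n N₁ N₂) := by
  classical
  exact Fintype.ofInjective
    (β := (Fin n × Mode N₁ N₂) ⊕ (Fin n × Mode N₁ N₂) ⊕ Mode N₁ N₂)
    (fun
      | .f i s => .inl (i, s)
      | .g i t => .inr (.inl (i, t))
      | .h k => .inr (.inr k))
    (by rintro (⟨i, s⟩ | ⟨i, s⟩ | s) (⟨j, t⟩ | ⟨j, t⟩ | t) h <;> simp_all)

/-- The index of a relation. -/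
abbrev RelIndex (N₁ N₂ : ℕ) : Type := Set.Icc (-(2 * (N₁ : ℤ))) (2 * (N₂ : ℤ))

theorem half_mem (l : RelIndex N₁ N₂) : (l : ℤ) / 2 ∈ Set.Icc (-(N₁ : ℤ)) (N₂ : ℤ) := by
  obtain ⟨l, h1, h2⟩ := l
  exact ⟨by dsimp only; omega, by dsimp only; omega⟩

/-- The bounds on `l` are even, so an odd `l` stays strictly below the upper one. -/
theorem half_add_one_mem (l : RelIndex N₁ N₂) (hl : ¬ (l : ℤ) % 2 = 0) :
    (l : ℤ) / 2 + 1 ∈ Set.Icc (-(N₁ : ℤ)) (N₂ : ℤ) := by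
  obtain ⟨l, h1, h2⟩ := l
  dsimp only at hl
  exact ⟨by dsimp only; omega, by dsimp only; omega⟩

/-- The first factor of the middle term, `h[k]` or `gₙ[k]`. -/
def middleLeft (i : Fin n) (l : RelIndex N₁ N₂) : Gen n N₁ N₂ :=
  if (l : ℤ) % 2 = 0 then .h ⟨(l : ℤ) / 2, half_mem l⟩ else .g i ⟨(l : ℤ) / 2, half_mem l⟩

/-- The second factor of the middle term, `h[k]` or `fⁿ[k + 1]`. -/
def middleRight (i : Fin n) (l : RelIndex N₁ N₂) : Gen n N₁ N₂ :=
  if hl : (l : ℤ) % 2 = 0 then .h ⟨(l : ℤ) / 2, half_mem l⟩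
  else .f i ⟨(l : ℤ) / 2 + 1, half_add_one_mem l hl⟩

theorem level_middleLeft {i : Fin n} (hi : (i : ℕ) + 1 = n) (l : RelIndex N₁ N₂) :
    (middleLeft i l).level = n * (l : ℤ) := by
  have hi' : ((i : ℕ) : ℤ) + 1 = n := by exact_mod_cast hi
  have hdiv := Int.mul_ediv_add_emod (l : ℤ) 2
  unfold middleLeft
  split_ifs with h
  · simp only [Gen.level]
    rw [h, add_zero] at hdiv
    conv_rhs => rw [← hdiv]
    ring
  · simp only [Gen.level]
    have h1 : (l : ℤ) % 2 = 1 := by omega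
    rw [h1] at hdiv
    conv_rhs => rw [← hdiv]
    rw [hi']
    ring

theorem level_middleRight {i : Fin n} (hi : (i : ℕ) + 1 = n) (l : RelIndex N₁ N₂) :
    (middleRight i l).level = n * (l : ℤ) := by
  have hi' : ((i : ℕ) : ℤ) + 1 = n := by exact_mod_cast hi
  have hdiv := Int.mul_ediv_add_emod (l : ℤ) 2
  unfold middleRight
  split_ifs with h
  · simp only [Gen.level]
    rw [h, add_zero] at hdiv
    conv_rhs => rw [← hdiv]
    ring
  · simp only [Gen.level]
    have h1 : (l : ℤ) % 2 = 1 := by omega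
    rw [h1] at hdiv
    conv_rhs => rw [← hdiv]
    rw [hi']
    ring

/-- Used with `a` the difference of two modes and `c` a small combination of indices, whose bounds
determine `a`. -/
theorem eq_of_two_mul_sub {m a c d : ℤ} (h : 2 * m * a = c) (h1 : 2 * m * (d - 1) < c)
    (h2 : c < 2 * m * (d + 1)) (hm : 0 < m) : a = d := by
  subst h
  have h3 : d - 1 < a := lt_of_mul_lt_mul_left h1 (by omega)
  have h4 : a < d + 1 := lt_of_mul_lt_mul_left h2 (by omega)
  omega

/-- Modulo 2n the levels of `f^j`, `h`, `g_j` are -j, 0, j with 1 ≤ j ≤ n, so distinct types meet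
only in -n ≡ n. -/
theorem exists_middle {i : Fin n} (hi : (i : ℕ) + 1 = n) (α β : Gen n N₁ N₂)
    (h : α.level = β.level) (hαβ : α = β → α.IsH) :
    ∃ l : RelIndex N₁ N₂, (α = middleLeft i l ∧ β = middleRight i l) ∨
      (α = middleRight i l ∧ β = middleLeft i l) := by
  have hn : (0 : ℤ) < n := by omega
  have hfg : ∀ (j j' : Fin n) (s t : Mode N₁ N₂),
      (Gen.f j s : Gen n N₁ N₂).level = (Gen.g j' t : Gen n N₁ N₂).level →
      ∃ l : RelIndex N₁ N₂, Gen.g j' t = middleLeft i l ∧ Gen.f j s = middleRight i l := by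
    rintro j j' ⟨s, hs⟩ ⟨t, ht⟩ h
    simp only [Gen.level] at h
    have hj := j.isLt
    have hj' := j'.isLt
    have hst : s - t = 1 := by
      refine eq_of_two_mul_sub (m := n) (c := (j : ℕ) + (j' : ℕ) + 2) ?_ ?_ ?_ hn
      · linarith
      · rw [sub_self, mul_zero]; omega
      · linarith
    have hs' : s = t + 1 := by omega
    subst hs'
    have hjj : ((j : ℕ) : ℤ) + ((j' : ℕ) : ℤ) + 2 = 2 * n := by linarith
    have h1 : j = i := Fin.ext (by omega)
    have h2 : j' = i := Fin.ext (by omega)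
    subst h2
    subst h1
    have hodd : ¬ (2 * t + 1) % 2 = 0 := by omega
    have hhalf : (2 * t + 1) / 2 = t := by omega
    refine ⟨⟨2 * t + 1, ?_, ?_⟩, ?_, ?_⟩
    · have := ht.1; omega
    · have := hs.2; omega
    · simp [middleLeft, hhalf]
    · simp [middleRight, hhalf]
  obtain ⟨j, s⟩ | ⟨j, s⟩ | s := α <;> obtain ⟨j', t⟩ | ⟨j', t⟩ | t := β
  · exfalso
    simp only [Gen.level] at h
    have hj := j.isLt
    have hj' := j'.isLt
    have hst : (s : ℤ) - t = 0 :=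
      eq_of_two_mul_sub (m := n) (c := (j : ℕ) - (j' : ℕ)) (by linarith) (by linarith)
        (by linarith) hn
    have hs : s = t := Subtype.ext (by omega)
    subst hs
    exact hαβ (by rw [Fin.ext (a := j) (b := j') (by omega)])
  · obtain ⟨l, h1, h2⟩ := hfg _ _ _ _ h
    exact ⟨l, Or.inr ⟨h2, h1⟩⟩
  · exfalso
    simp only [Gen.level] at h
    have hj := j.isLt
    have hst : (s : ℤ) - t = 0 :=
      eq_of_two_mul_sub (m := n) (c := (j : ℕ) + 1) (by linarith) (by linarith)
        (by linarith) hn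
    have hs : (s : ℤ) = t := by omega
    rw [hs] at h
    omega
  · obtain ⟨l, h1, h2⟩ := hfg _ _ _ _ h.symm
    exact ⟨l, Or.inl ⟨h1, h2⟩⟩
  · exfalso
    simp only [Gen.level] at h
    have hj := j.isLt
    have hj' := j'.isLt
    have hst : (s : ℤ) - t = 0 :=
      eq_of_two_mul_sub (m := n) (c := (j' : ℕ) - (j : ℕ)) (by linarith) (by linarith)
        (by linarith) hn
    have hs : s = t := Subtype.ext (by omega)
    subst hs
    exact hαβ (by rw [Fin.ext (a := j) (b := j') (by omega)])
  · exfalso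
    simp only [Gen.level] at h
    have hj := j.isLt
    have hst : (t : ℤ) - s = 0 :=
      eq_of_two_mul_sub (m := n) (c := (j : ℕ) + 1) (by linarith) (by linarith)
        (by linarith) hn
    have hs : (s : ℤ) = t := by omega
    rw [hs] at h
    omega
  · exfalso
    simp only [Gen.level] at h
    have hj := j'.isLt
    have hst : (t : ℤ) - s = 0 :=
      eq_of_two_mul_sub (m := n) (c := (j' : ℕ) + 1) (by linarith) (by linarith)
        (by linarith) hn
    have hs : (s : ℤ) = t := by omega
    rw [hs] at h
    omega
  · exfalso
    simp only [Gen.level] at h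
    have hj := j'.isLt
    have hst : (s : ℤ) - t = 0 :=
      eq_of_two_mul_sub (m := n) (c := (j' : ℕ) + 1) (by linarith) (by linarith)
        (by linarith) hn
    have hs : (s : ℤ) = t := by omega
    rw [hs] at h
    omega
  · simp only [Gen.level] at h
    have hst : (s : ℤ) = t := mul_left_cancel₀ (by positivity) h
    have hs : s = t := Subtype.ext hst
    subst hs
    have h1 := s.2.1
    have h2 := s.2.2
    refine ⟨⟨2 * (s : ℤ), by omega, by omega⟩, Or.inl ⟨?_, ?_⟩⟩
    · simp [middleLeft]
    · simp [middleRight]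

/-- Isolates the summand with the middle term, once for each of the nested sums. -/
theorem sum_sub_mem {k M ι : Type*} [Ring k] [AddCommGroup M] [Module k M] [Fintype ι]
    (V : Submodule k M) {F : ι → M} {m : M} (i : ι) (hi : F i - m ∈ V)
    (h : ∀ j, j ≠ i → F j ∈ V) : ∑ j, F j - m ∈ V := by
  classical
  rw [← Finset.add_sum_erase _ _ (Finset.mem_univ i), add_sub_right_comm]
  exact V.add_mem hi (V.sum_mem fun j hj => h j (Finset.ne_of_mem_erase hj))

/-- The total level is 2nl, so factors of unequal level lie on both sides of nl. Equal levels occur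
for one triple of indices only, hence the middle term has coefficient 1. -/
theorem relation_sub_mem {i : Fin n} (hi : (i : ℕ) + 1 = n) (l : RelIndex N₁ N₂) :
    relation n N₁ N₂ l - X (middleLeft i l) * X (middleRight i l) ∈
      Submodule.span ℂ {P | ∃ γ δ : Gen n N₁ N₂, γ.level < (middleLeft i l).level ∧
        (middleLeft i l).level < δ.level ∧ γ.level + δ.level = 2 * (middleLeft i l).level ∧
        P = X γ * X δ} := by
  rw [level_middleLeft hi]
  set V := Submodule.span ℂ {P : MvPolynomial (Gen n N₁ N₂) ℂ | ∃ γ δ : Gen n N₁ N₂, γ.level < n * (l : ℤ) ∧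
        n * (l : ℤ) < δ.level ∧ γ.level + δ.level = 2 * (n * (l : ℤ)) ∧
        P = X γ * X δ} with hV
  have hn : (0 : ℤ) < n := by omega
  have hpair : ∀ γ δ : Gen n N₁ N₂, γ.level + δ.level = 2 * (n * (l : ℤ)) →
      γ.level ≠ δ.level → (X γ * X δ : MvPolynomial (Gen n N₁ N₂) ℂ) ∈ V := by
    intro γ δ hs hne
    rcases lt_or_gt_of_ne hne with h | h
    · exact Submodule.subset_span ⟨γ, δ, by omega, by omega, hs, rfl⟩
    · exact Submodule.subset_span ⟨δ, γ, by omega, by omega, by omega, mul_comm _ _⟩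
  have hh : ∀ s t : Mode N₁ N₂, (s : ℤ) + t = l → (s : ℤ) ≠ t →
      (X (Gen.h s) * X (Gen.h t) : MvPolynomial (Gen n N₁ N₂) ℂ) ∈ V := by
    intro s t hst hne
    refine hpair _ _ ?_ ?_
    · simp only [Gen.level, ← hst]; ring
    · intro h
      simp only [Gen.level] at h
      exact hne (mul_left_cancel₀ (by positivity) h)
  have hfg : ∀ (j : Fin n) (s t : Mode N₁ N₂), (s : ℤ) + t = l →
      ¬ (j = i ∧ (s : ℤ) = t + 1) → (X (Gen.f j s) * X (Gen.g j t) : MvPolynomial (Gen n N₁ N₂) ℂ) ∈ V := by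
    intro j s t hst hne
    refine hpair _ _ ?_ ?_
    · simp only [Gen.level, ← hst]; ring
    · intro h
      simp only [Gen.level] at h
      have hj := j.isLt
      have h1 : (s : ℤ) - t = 1 := by
        refine eq_of_two_mul_sub (m := n) (c := 2 * ((j : ℕ) + 1)) ?_ ?_ ?_ hn
        · linarith
        · rw [sub_self, mul_zero]; omega
        · linarith
      have hs : (s : ℤ) = t + 1 := by omega
      rw [hs] at h
      exact hne ⟨Fin.ext (by have : ((j : ℕ) : ℤ) + 1 = n := by linarith
                             omega), hs⟩
  unfold relation
  by_cases hl : (l : ℤ) % 2 = 0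
  · simp only [middleLeft, middleRight, hl, if_true, dif_pos]
    have hfg' : ∀ s t : Mode N₁ N₂, (s : ℤ) + t = l →
        ∑ j : Fin n, (X (Gen.f j s) * X (Gen.g j t) : MvPolynomial (Gen n N₁ N₂) ℂ) ∈ V := fun s t hst =>
      V.sum_mem fun j _ => hfg j s t hst fun h => by omega
    refine sum_sub_mem V ⟨(l : ℤ) / 2, half_mem l⟩ ?_ fun s hs => V.sum_mem fun t _ => ?_
    · refine sum_sub_mem V ⟨(l : ℤ) / 2, half_mem l⟩ ?_ fun t ht => ?_
      · rw [if_pos (by dsimp only; omega), add_sub_cancel_right]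
        exact hfg' _ _ (by dsimp only; omega)
      · rw [if_neg]
        · exact V.zero_mem
        · intro h
          exact ht (Subtype.ext (by dsimp only at h ⊢; omega))
    · split_ifs with hst
      · refine V.add_mem (hfg' s t hst) (hh s t hst fun h => hs (Subtype.ext ?_))
        dsimp only
        omega
      · exact V.zero_mem
  · simp only [middleLeft, middleRight, hl, if_false, dif_neg, not_false_eq_true]
    have hh' : ∀ s t : Mode N₁ N₂, (s : ℤ) + t = l →
        (X (Gen.h s) * X (Gen.h t) : MvPolynomial (Gen n N₁ N₂) ℂ) ∈ V := fun s t hst => hh s t hst fun h => by omega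
    refine sum_sub_mem V ⟨(l : ℤ) / 2 + 1, half_add_one_mem l hl⟩ ?_
      fun s hs => V.sum_mem fun t _ => ?_
    · refine sum_sub_mem V ⟨(l : ℤ) / 2, half_mem l⟩ ?_ fun t ht => ?_
      · rw [if_pos (by dsimp only; omega), add_sub_right_comm]
        refine V.add_mem (sum_sub_mem V i ?_ fun j hj => ?_) (hh' _ _ (by dsimp only; omega))
        · rw [mul_comm, sub_self]
          exact V.zero_mem
        · exact hfg j _ _ (by dsimp only; omega) fun h => hj h.1
      · rw [if_neg]
        · exact V.zero_mem
        · intro h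
          exact ht (Subtype.ext (by dsimp only at h ⊢; omega))
    · split_ifs with hst
      · refine V.add_mem (V.sum_mem fun j _ => hfg j s t hst fun h => hs (Subtype.ext ?_))
          (hh' s t hst)
        have := h.2
        dsimp only
        omega
      · exact V.zero_mem

/-- The relations of the algebra of quasimaps, with the middle terms of the diagram. -/
noncomputable def middleTerms (i : Fin n) (hi : (i : ℕ) + 1 = n) :
    MiddleTerms ℂ (Gen n N₁ N₂) (RelIndex N₁ N₂) where
  level := Gen.level
  loop := Gen.IsH
  p := middleLeft i
  q := middleRight i
  r := fun l => relation n N₁ N₂ l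
  level_eq := fun l => by rw [level_middleLeft hi, level_middleRight hi]
  level_injective := fun l l' h => by
    rw [level_middleLeft hi, level_middleLeft hi] at h
    exact Subtype.ext (mul_left_cancel₀ (by omega) h)
  loop_of_eq := fun l h => by
    unfold middleLeft middleRight at *
    split_ifs at * with hl
    trivial
  exists_middle := exists_middle hi
  r_sub_mem := relation_sub_mem hi

end OddQuadric

theorem mainTheorem5 (n N₁ N₂ : ℕ) (hn : 1 ≤ n) :
    GradedAlg.IsKoszul ℂ (OddQuadric.grading n N₁ N₂) ∧
    ∀ lt : OddQuadric.Gen n N₁ N₂ → OddQuadric.Gen n N₁ N₂ → Prop,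
      IsStrictTotalOrder (OddQuadric.Gen n N₁ N₂) lt →
      (∀ α β : OddQuadric.Gen n N₁ N₂, α.level < β.level → lt α β) →
      GradedAlg.IsPBW ℂ (OddQuadric.grading n N₁ N₂) lt (OddQuadric.gen n N₁ N₂) ∧
      ∀ w : List (OddQuadric.Gen n N₁ N₂),
        GradedAlg.IsPBWWord ℂ lt (OddQuadric.gen n N₁ N₂) w ↔ OddQuadric.IsGMonomial w := by
  let D : MiddleTerms ℂ (OddQuadric.Gen n N₁ N₂) (OddQuadric.RelIndex N₁ N₂) :=
    -- The element `n - 1` of `Fin n` stands for the last index n.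
    OddQuadric.middleTerms ⟨n - 1, by omega⟩ (by dsimp only; omega)
  have hI : OddQuadric.relationIdeal n N₁ N₂ = Ideal.span (Set.range D.r) := by
    rw [OddQuadric.relationIdeal, Set.image_eq_range]
    rfl
  exact D.isKoszul_and_isPBW hI
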